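/- Let $n\ge 1$ and let $K:\mathbb{R}^n\setminus\{0\}\to[0,+\infty)$ satisfy $K(-x)=K(x)$ and $\min\{1,|x|\}K(x)\in L^1(\mathbb{R}^n)$. All sets below are Lebesgue measurable. Put $$\mathrm{Per}_K(F)=\int_F\int_{\mathbb{R}^n\setminus F}K(x-y)\,dy\,dx,\qquad \mathrm{Per}_K(F,\Omega)=\int_F\int_{\Omega\setminus F}K(x-y)\,dy\,dx+\int_{F\cap\Omega}\int_{\mathbb{R}^n\setminus(\Omega\cup F)}K(x-y)\,dy\,dx,$$ let $d_E(x)=d(x,\mathbb{R}^n\setminus E)-d(x,E)$ be the signed distance, and let $d(A,B)=\inf\{|a-b|:a\in\partial A,\ b\in\partial B\}$ (equal to $+\infty$ if $\partial A$ or $\partial B$ is empty). For a nonempty bounded set $E$ and $h>0$, $T_h(E)$ denotes the set of points of density one of a minimizer of $F\mapsto \mathrm{Per}_K(F)-\frac1h\int_F d_E(x)\,dx$ among all measurable $F\subseteq\mathbb{R}^n$, and $T_h(\emptyset)=\emptyset$. A discrete flow from $E$ is given by $E_h(t)=T_h^{(k)}(E)$ for $t\in[kh,(k+1)h)$, $k=0,1,2,\dots$,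 where $T_h^{(0)}(E)=E$ and an arbitrary minimizer may be chosen in each step. For a set $F$ with compact boundary of class $C^{1,1}$ and $x\in\partial F$ let $H^K_F(x)=\lim_{\varepsilon\searrow0}\int_{\mathbb{R}^n\setminus B(x,\varepsilon)}(\chi_{\mathbb{R}^n\setminus F}(y)-\chi_F(y))K(x-y)\,dy$. For a general set $E$ and $x\in\partial E$, $H^K_E(x)\ge c$ in the viscosity sense means that for every $F\subseteq E$ with compact boundary of class $C^{1,1}$ and $x\in\partial F$ the limit $H^K_F(x)$ exists and is $\ge c$. **Proposition.** For every $r>0$ there is $h_0>0$ (depending only on $r$, $n$ and $K$) such that the following holds. Let $\Omega\subseteq\mathbb{R}^n$ be open, let $E$ be a nonempty set with $E\subset\subset\Omega$ and $d(E,\Omega)\ge r$, and let $\delta>0$ be such that $E$ is strongly $K$-outward minimizing in $\Omega$ with constant $\delta$, that is, $$\mathrm{Per}_K(E,\Omega)\le \mathrm{Per}_K(F,\Omega)-\delta|F\setminus E|\qquad\text{for all } F\supseteq E \text{ with } F\setminus E\subset\subset\Omega .$$ Let $0<h\le\min\left(h_0,\frac{d(E,\Omega)}{\delta}\right)$. 1.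 If $E$ has empty interior, then $T_h(E)=\emptyset$ (the minimization problem has a solution, and $\emptyset$ is the only possible value of $T_h(E)$). 2. Suppose that $E$ has nonempty interior and contains every open set $U$ with $|U\setminus E|=0$ (this holds if $E$ is closed, or if $E$ is the set of its points of density one). Then every discrete flow from $E$ satisfies $$d(E_h(t),E_h(t+h))\ge\delta h\qquad\text{for all } t\ge0.$$ If moreover, for every $c>0$, $$\lim_{\rho\searrow0}\ \sup_{|e|=1}\int_{\{|y|<\rho,\ |y\cdot e|\le c|y|^2\}}K(y)\,dy=0$$ (which holds for every radial kernel as above and every kernel dominated by such a radial one, and ensures that $H^K_F$ is finite and continuous on $\partial F$ if $F$ has compact $C^{1,1}$ boundary), then also $$H^K_{E_h(t)}(x)\ge\delta\ \text{ in the viscosity sense, for all } t\ge0 \text{ and } x\in\partial E_h(t).$$ -/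

import Mathlib

open Set Filter Topology MeasureTheory
open scoped ENNReal NNReal

namespace KFlow

noncomputable section

/-- Euclidean space of dimension `n`. -/
abbrev Euc (n : ℕ) : Type := EuclideanSpace ℝ (Fin n)

/-- The standing assumptions on the interaction kernel: nonnegative and even away from the origin,
with `min {1, |x|} K(x)` Lebesgue integrable. -/
structure IsKernel {n : ℕ} (K : Euc n → ℝ) : Prop where
  nonneg : ∀ x, x ≠ 0 → 0 ≤ K x
  even : ∀ x, x ≠ 0 → K (-x) = K x
  integrable : Integrable (fun x => min 1 ‖x‖ * K x) volume

/-- The mass of the kernel near the origin, between two tangent paraboloids of any fixed opening,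
is small uniformly in the direction of the paraboloids. Radial kernels satisfying `IsKernel`, and
kernels dominated by such a radial one, have this property. It makes the `K`-curvature of sets with
`C^{1,1}` boundary well defined, finite and continuous. -/
def UniformlyParabolic {n : ℕ} (K : Euc n → ℝ) : Prop :=
  ∀ r : ℝ, 0 < r → ∀ η : ℝ, 0 < η → ∃ ρ : ℝ, 0 < ρ ∧ ∀ e : Euc n, ‖e‖ = 1 →
    ∫⁻ y in {y : Euc n | ‖y‖ < ρ ∧ |inner ℝ y e| ≤ r * ‖y‖ ^ 2}, ENNReal.ofReal (K y)
      ≤ ENNReal.ofReal η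

/-- The interaction `∫_A ∫_B K(x - y) dy dx`. -/
def interaction {n : ℕ} (K : Euc n → ℝ) (A B : Set (Euc n)) : ℝ≥0∞ :=
  ∫⁻ x in A, ∫⁻ y in B, ENNReal.ofReal (K (x - y))

/-- The nonlocal perimeter `Per_K(E)`. -/
def perK {n : ℕ} (K : Euc n → ℝ) (E : Set (Euc n)) : ℝ≥0∞ :=
  interaction K E Eᶜ

/-- The nonlocal perimeter `Per_K(E, Ω)` of `E` relative to `Ω`. -/
def perKIn {n : ℕ} (K : Euc n → ℝ) (E Ω : Set (Euc n)) : ℝ≥0∞ :=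
  interaction K E (Ω \ E) + interaction K (E ∩ Ω) (Ω ∪ E)ᶜ

/-- `A ⊂⊂ Ω`. -/
def CompactlyIn {n : ℕ} (A Ω : Set (Euc n)) : Prop :=
  IsCompact (closure A) ∧ closure A ⊆ Ω

/-- `E` is strongly `K`-outward minimizing in `Ω` with constant `δ`:
`Per_K(E, Ω) ≤ Per_K(F, Ω) - δ |F \ E|` for all measurable `F ⊇ E` with `F \ E ⊂⊂ Ω`. -/
def StronglyOutwardMinimizing {n : ℕ} (K : Euc n → ℝ) (Ω E : Set (Euc n)) (δ : ℝ) : Prop :=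
  ∀ F : Set (Euc n), NullMeasurableSet F volume → E ⊆ F → CompactlyIn (F \ E) Ω →
    perKIn K E Ω + ENNReal.ofReal δ * volume (F \ E) ≤ perKIn K F Ω

/-- The distance between two sets, measured between their boundaries; it is `∞` if one of the
boundaries is empty. -/
def bdryDist {n : ℕ} (A B : Set (Euc n)) : ℝ≥0∞ :=
  ⨅ a ∈ frontier A, ⨅ b ∈ frontier B, edist a b

/-- The signed distance from `E`, positive inside `E`. -/
def signedDist {n : ℕ} (E : Set (Euc n)) (x : Euc n) : ℝ :=
  Metric.infDist x Eᶜ - Metric.infDist x E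

/-- The functional `Per_K(F) - (1/h) ∫_F d_E(x) dx`. For bounded `E` the positive part of `d_E` has
a finite integral, so the value is a well-defined element of `(-∞, ∞]`. -/
def energy {n : ℕ} (K : Euc n → ℝ) (h : ℝ) (E F : Set (Euc n)) : EReal :=
  ((perK K F + ENNReal.ofReal (1 / h) * ∫⁻ x in F, ENNReal.ofReal (-signedDist E x) : ℝ≥0∞) : EReal)
    - ((ENNReal.ofReal (1 / h) * ∫⁻ x in F, ENNReal.ofReal (signedDist E x) : ℝ≥0∞) : EReal)

/-- `F` minimizes the functional above among all Lebesgue measurable sets. -/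
def IsMinimizer {n : ℕ} (K : Euc n → ℝ) (h : ℝ) (E F : Set (Euc n)) : Prop :=
  NullMeasurableSet F volume ∧
    ∀ G : Set (Euc n), NullMeasurableSet G volume → energy K h E F ≤ energy K h E G

/-- The Lebesgue representative of `E`: the set of points of density one. -/
def lebesgueRep {n : ℕ} (E : Set (Euc n)) : Set (Euc n) :=
  {x | Tendsto (fun r : ℝ => volume (E ∩ Metric.ball x r) / volume (Metric.ball x r))
    (𝓝[>] 0) (𝓝 1)}

/-- `B` is a possible value of `T_h(A)`, for bounded `A`: the Lebesgue representative of a minimizer,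
with the convention `T_h(∅) = ∅`. -/
def IsStep {n : ℕ} (K : Euc n → ℝ) (h : ℝ) (A B : Set (Euc n)) : Prop :=
  (A = ∅ ∧ B = ∅) ∨
    (A.Nonempty ∧ Bornology.IsBounded A ∧ ∃ F, IsMinimizer K h A F ∧ B = lebesgueRep F)

/-- `Eh` is a piecewise constant flow with time step `h` starting from `E`:
`Eh t = T_h^{(k)}(E)` for `t ∈ [kh, (k+1)h)`, with some choice of the minimizer in each step. -/
def IsDiscreteFlow {n : ℕ} (K : Euc n → ℝ) (h : ℝ) (E : Set (Euc n)) (Eh : ℝ → Set (Euc n)) :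
    Prop :=
  ∃ A : ℕ → Set (Euc n), A 0 = E ∧ (∀ k, IsStep K h (A k) (A (k + 1))) ∧
    ∀ (k : ℕ) (t : ℝ), t ∈ Ico (k * h) ((k + 1) * h) → Eh t = A k

/-- `F` has compact boundary of class `C^{1,1}`: near each boundary point `F` is, up to points of the
hypersurface `φ = 0`, the sublevel set `φ < 0` of a function with Lipschitz derivative that does not
vanish at the point. -/
def HasCompactC11Boundary {n : ℕ} (F : Set (Euc n)) : Prop :=
  IsCompact (frontier F) ∧
    ∀ x ∈ frontier F, ∃ (U : Set (Euc n)) (φ : Euc n → ℝ) (C : ℝ≥0),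
      IsOpen U ∧ x ∈ U ∧ DifferentiableOn ℝ φ U ∧ LipschitzOnWith C (fderiv ℝ φ) U ∧
      fderiv ℝ φ x ≠ 0 ∧ ∀ y ∈ U, (φ y < 0 → y ∈ F) ∧ (0 < φ y → y ∉ F)

/-- The integral of `(χ_{Fᶜ}(y) - χ_F(y)) K(x - y)` over the complement of `B(x, ε)`. -/
def truncCurv {n : ℕ} (K : Euc n → ℝ) (F : Set (Euc n)) (x : Euc n) (ε : ℝ) : ℝ :=
  ∫ y in (Metric.ball x ε)ᶜ,
    (Fᶜ.indicator (fun _ => (1 : ℝ)) y - F.indicator (fun _ => (1 : ℝ)) y) * K (x - y)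

/-- `L` is the `K`-curvature of the regular set `F` at `x`. -/
def HasCurv {n : ℕ} (K : Euc n → ℝ) (F : Set (Euc n)) (x : Euc n) (L : EReal) : Prop :=
  Tendsto (fun ε : ℝ => (truncCurv K F x ε : EReal)) (𝓝[>] 0) (𝓝 L)

/-- `H^K_E(x) ≥ c` in the viscosity sense, for `x ∈ ∂E`: every set `F ⊆ E` with compact `C^{1,1}`
boundary through `x` has `K`-curvature at least `c` at `x`. -/
def ViscCurvGE {n : ℕ} (K : Euc n → ℝ) (E : Set (Euc n)) (x : Euc n) (c : ℝ) : Prop :=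
  ∀ F : Set (Euc n), HasCompactC11Boundary F → F ⊆ E → x ∈ frontier F →
    ∃ L : EReal, HasCurv K F x L ∧ (c : EReal) ≤ L

/-- `E` contains every open set in which it has full measure. This holds for closed sets and for sets
that coincide with their Lebesgue representative. -/
def ContainsFullOpens {n : ℕ} (E : Set (Euc n)) : Prop :=
  ∀ U : Set (Euc n), IsOpen U → volume (U \ E) = 0 → U ⊆ E

end

end KFlow

namespace KFlow

/-! Everything rests on one inequality. Submodularity of the perimeter turns strong outward
minimality of E into Per(G ∩ E) + δ|G \ E| ≤ Per(G) for every measurable G ⊂⊂ Ω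
(`Admissible.wper_inter_add_le`). By translation invariance, E may be replaced here by a translate E
- v when G ⊆ E and |v| is smaller than the distance from E to the complement of Ω.

Distance estimate. A minimizer F stays in E up to a null set, because for small h the penalty far
from E beats the cost of cutting F along a level set of the distance
(`IsMinimizer.volume_sdiff_eq_zero`). If |v| < δh, replacing F by F ∩ (E - v) loses at most |v|/h <
δ per unit of removed volume, while the perimeter drops by at least δ per unit; so nothing is
removed. A density argument (`ball_subset_of_volume_sdiff_translate`) upgrades this to: the ball of
radius δh about each point of T_h(E) lies in E.

Iteration. T_h(E) is again outward minimizing with the same δ (`IsMinimizer.outMin`). A competitor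
is cut down to points of depth at least δh in E, gaining δ times the removed volume; there d_E/h ≥
δ, and minimality of T_h(E) supplies the rest. Hence all hypotheses persist along the flow
(`Admissible.step`).

Curvature. If a regular F ⊆ A touches ∂A at x with curvature below δ, enlarge an inner tangent ball
slightly and let B be the part of it outside A. The spheres concentric with that ball, completed by
F away from x, foliate B by surfaces of curvature at most some c < δ (`IsTrapped.exists_foliation`).
Integrating over B (`wint_le_of_foliation`) shows that adding B to A raises the perimeter by at most
c|B|, against outward minimality of A.

If E has empty interior then d_E ≤ 0, so the empty set is a minimizer, and any other minimizer has
zero perimeter and hence zero volume. -/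

/-- An even measurable weight with values in `[0, ∞]`. -/
structure IsWeight {n : ℕ} (k : Euc n → ℝ≥0∞) : Prop where
  aemeasurable : AEMeasurable k volume
  even : ∀ x, k (-x) = k x

/-- The interaction of two sets for a weight with values in `[0, ∞]`. -/
noncomputable def wint {n : ℕ} (k : Euc n → ℝ≥0∞) (A B : Set (Euc n)) : ℝ≥0∞ :=
  ∫⁻ x in A, ∫⁻ y in B, k (x - y)

/-- The perimeter of a set for a weight with values in `[0, ∞]`. -/
noncomputable def wper {n : ℕ} (k : Euc n → ℝ≥0∞) (A : Set (Euc n)) : ℝ≥0∞ := wint k A Aᶜ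

/-! ### Interactions and perimeters for an even weight. -/

section Weight

variable {n : ℕ} {k : Euc n → ℝ≥0∞}

theorem IsWeight.sub_comm (hk : IsWeight k) (x y : Euc n) : k (x - y) = k (y - x) := by
  rw [← neg_sub, hk.even]

theorem IsWeight.aemeasurable_sub (hk : IsWeight k) :
    AEMeasurable (fun p : Euc n × Euc n => k (p.1 - p.2)) (volume.prod volume) :=
  hk.aemeasurable.comp_quasiMeasurePreserving (quasiMeasurePreserving_sub_of_right_invariant _ _)

theorem IsWeight.aemeasurable_sub_restrict (hk : IsWeight k) (A B : Set (Euc n)) :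
    AEMeasurable (fun p : Euc n × Euc n => k (p.1 - p.2))
      ((volume.restrict A).prod (volume.restrict B)) := by
  rw [Measure.prod_restrict]
  exact hk.aemeasurable_sub.restrict

theorem IsWeight.aemeasurable_inner (hk : IsWeight k) (A B : Set (Euc n)) :
    AEMeasurable (fun x : Euc n => ∫⁻ y in B, k (x - y)) (volume.restrict A) :=
  (hk.aemeasurable_sub_restrict A B).lintegral_prod_right'

theorem wint_comm (hk : IsWeight k) (A B : Set (Euc n)) : wint k A B = wint k B A := by
  unfold wint
  rw [lintegral_lintegral_swap (hk.aemeasurable_sub_restrict A B)]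
  simp_rw [hk.sub_comm]

theorem wint_congr {A A' B B' : Set (Euc n)} (hA : A =ᵐ[volume] A') (hB : B =ᵐ[volume] B') :
    wint k A B = wint k A' B' := by
  unfold wint
  rw [Measure.restrict_congr_set hA, Measure.restrict_congr_set hB]

theorem wper_congr {A A' : Set (Euc n)} (hA : A =ᵐ[volume] A') : wper k A = wper k A' :=
  wint_congr hA hA.compl

theorem wint_mono {A A' B B' : Set (Euc n)} (hA : A ⊆ A') (hB : B ⊆ B') :
    wint k A B ≤ wint k A' B' :=
  lintegral_mono' (Measure.restrict_mono_set _ hA)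
    fun _ => lintegral_mono' (Measure.restrict_mono_set _ hB) le_rfl

theorem wint_union_left (A : Set (Euc n)) {A' : Set (Euc n)} (B : Set (Euc n))
    (hA' : NullMeasurableSet A' volume) (h : Disjoint A A') :
    wint k (A ∪ A') B = wint k A B + wint k A' B := by
  unfold wint
  rw [Measure.restrict_union₀ h.aedisjoint hA', lintegral_add_measure]

theorem wint_union_right (hk : IsWeight k) (A : Set (Euc n)) (B : Set (Euc n)) {B' : Set (Euc n)}
    (hB' : NullMeasurableSet B' volume) (h : Disjoint B B') :
    wint k A (B ∪ B') = wint k A B + wint k A B' := by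
  rw [wint_comm hk, wint_union_left B A hB' h, wint_comm hk B, wint_comm hk B']

theorem wint_translate (v : Euc n) (A B : Set (Euc n)) :
    wint k ((fun x => x + v) ⁻¹' A) ((fun x => x + v) ⁻¹' B) = wint k A B := by
  unfold wint
  have hmp := measurePreserving_add_right (volume : Measure (Euc n)) v
  have he : MeasurableEmbedding (fun x : Euc n => x + v) := measurableEmbedding_addRight v
  rw [← hmp.setLIntegral_comp_preimage_emb he (fun x => ∫⁻ y in B, k (x - y)) A]
  refine lintegral_congr fun x => ?_
  rw [← hmp.setLIntegral_comp_preimage_emb he (fun y => k (x + v - y))]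
  simp

theorem wper_translate (v : Euc n) (A : Set (Euc n)) :
    wper k ((fun x => x + v) ⁻¹' A) = wper k A := by
  unfold wper
  rw [← preimage_compl, wint_translate]

/-- Cut space into A ∩ B, A \ B, B \ A and the rest: the two sides have the same terms, except that
the right one also counts the interaction of A \ B with B \ A, in both orders. -/
theorem wper_inter_add_wper_union_le (hk : IsWeight k) {A B : Set (Euc n)}
    (hA : NullMeasurableSet A volume) (hB : NullMeasurableSet B volume) :
    wper k (A ∩ B) + wper k (A ∪ B) ≤ wper k A + wper k B := by
  set a := A ∩ B
  set b := A \ B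
  set c := B \ A
  set d := (A ∪ B)ᶜ
  have ha : NullMeasurableSet a volume := hA.inter hB
  have hb : NullMeasurableSet b volume := hA.diff hB
  have hc : NullMeasurableSet c volume := hB.diff hA
  have hd : NullMeasurableSet d volume := (hA.union hB).compl
  have hbc : Disjoint b c := by
    rw [Set.disjoint_left]; rintro x ⟨h1, h2⟩ ⟨h3, h4⟩; exact h2 h3
  have hbd : Disjoint b d := by
    rw [Set.disjoint_left]; rintro x ⟨h1, h2⟩ h3; exact h3 (Or.inl h1)
  have hcd : Disjoint c d := by
    rw [Set.disjoint_left]; rintro x ⟨h1, h2⟩ h3; exact h3 (Or.inr h1)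
  have hab : Disjoint a b := by
    rw [Set.disjoint_left]; rintro x ⟨h1, h2⟩ ⟨h3, h4⟩; exact h4 h2
  have hac : Disjoint a c := by
    rw [Set.disjoint_left]; rintro x ⟨h1, h2⟩ ⟨h3, h4⟩; exact h4 h1
  have e1 : aᶜ = b ∪ (c ∪ d) := by
    ext x; simp only [a, b, c, d, mem_compl_iff, mem_inter_iff, mem_union, Set.mem_sdiff]; tauto
  have e2 : A ∪ B = a ∪ (b ∪ c) := by
    ext x; simp only [a, b, c, mem_inter_iff, mem_union, Set.mem_sdiff]; tauto
  have e3 : A = a ∪ b := by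
    ext x; simp only [a, b, mem_inter_iff, mem_union, Set.mem_sdiff]; tauto
  have e4 : Aᶜ = c ∪ d := by
    ext x; simp only [c, d, mem_compl_iff, mem_union, Set.mem_sdiff]; tauto
  have e5 : B = a ∪ c := by
    ext x; simp only [a, c, mem_inter_iff, mem_union, Set.mem_sdiff]; tauto
  have e6 : Bᶜ = b ∪ d := by
    ext x; simp only [b, d, mem_compl_iff, mem_union, Set.mem_sdiff]; tauto
  have p1 : wper k a = wint k a b + (wint k a c + wint k a d) := by
    rw [wper, e1, wint_union_right hk _ _ (hc.union hd) (hbc.union_right hbd),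
      wint_union_right hk _ _ hd hcd]
  have p2 : wper k (A ∪ B) = wint k a d + (wint k b d + wint k c d) := by
    rw [wper, show (A ∪ B)ᶜ = d from rfl, e2,
      wint_union_left _ _ (hb.union hc) (hab.union_right hac), wint_union_left _ _ hc hbc]
  have p3 : wper k A = wint k a c + wint k a d + (wint k b c + wint k b d) := by
    rw [wper, e4, wint_union_right hk _ _ hd hcd]
    have q : ∀ T, wint k A T = wint k (a ∪ b) T := fun T => congrArg (wint k · T) e3
    rw [q, q, wint_union_left _ _ hb hab, wint_union_left _ _ hb hab]; ring
  have p4 : wper k B = wint k a b + wint k a d + (wint k c b + wint k c d) := by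
    rw [wper, e6, wint_union_right hk _ _ hd hbd]
    have q : ∀ T, wint k B T = wint k (a ∪ c) T := fun T => congrArg (wint k · T) e5
    rw [q, q, wint_union_left _ _ hc hac, wint_union_left _ _ hc hac]; ring
  rw [p1, p2, p3, p4]
  calc _ ≤ wint k a b + (wint k a c + wint k a d) + (wint k a d + (wint k b d + wint k c d))
        + (wint k b c + wint k c b) := le_self_add
    _ = _ := by ring

theorem lintegral_sub_left (f : Euc n → ℝ≥0∞) (x : Euc n) : ∫⁻ y, f (x - y) = ∫⁻ z, f z :=
  lintegral_sub_left_eq_self f x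

theorem wint_eq_setLIntegral_prod (hk : IsWeight k) (A B : Set (Euc n)) :
    wint k A B = ∫⁻ p in A ×ˢ B, k (p.1 - p.2) ∂(volume.prod volume) := by
  rw [← Measure.prod_restrict, lintegral_prod _ (hk.aemeasurable_sub_restrict A B)]
  rfl

theorem IsWeight.mul (hk : IsWeight k) {f : Euc n → ℝ≥0∞} (hf : Measurable f)
    (hf' : ∀ x, f (-x) = f x) : IsWeight fun x => f x * k x :=
  ⟨hf.aemeasurable.mul hk.aemeasurable, fun x => by rw [hk.even, hf']⟩

theorem wint_le_mul_volume_left (A B : Set (Euc n)) :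
    wint k A B ≤ (∫⁻ z, k z) * volume A := by
  unfold wint
  calc _ ≤ ∫⁻ _ in A, ∫⁻ z, k z := by
        refine lintegral_mono fun x => ?_
        exact (setLIntegral_le_lintegral _ _).trans (lintegral_sub_left k x).le
    _ = _ := by rw [setLIntegral_const]

theorem wint_le_mul_volume_right (hk : IsWeight k) (A B : Set (Euc n)) :
    wint k A B ≤ (∫⁻ z, k z) * volume B := by
  rw [wint_comm hk]
  exact wint_le_mul_volume_left B A

/-- A coarea inequality: by Tonelli, a pair (x, y) is separated only by the levels s in (u x, u y],
a set of length at most min(b - a, |x - y|) inside (a, b). This factor is what makes the kernel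
integrable. -/
theorem lintegral_wint_level_le (hk : IsWeight k) {u : Euc n → ℝ} (hu : LipschitzWith 1 u)
    (a b : ℝ) (X Y : Set (Euc n)) :
    AEMeasurable (fun s => wint k (X ∩ {x | u x < s}) (Y \ {x | u x < s}))
      (volume.restrict (Ioo a b)) ∧
    ∫⁻ s in Ioo a b, wint k (X ∩ {x | u x < s}) (Y \ {x | u x < s}) ≤
      wint (fun z => ENNReal.ofReal (min (b - a) ‖z‖) * k z)
        (X ∩ {x | u x < b}) (Y \ {x | u x ≤ a}) := by
  have hk' : IsWeight fun z => ENNReal.ofReal (min (b - a) ‖z‖) * k z :=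
    hk.mul (by fun_prop) (by simp)
  have hum := hu.continuous.measurable
  set ν := ((volume : Measure (Euc n)).prod (volume : Measure (Euc n))).restrict (X ×ˢ Y)
  let W : Set (ℝ × (Euc n × Euc n)) := {q | u q.2.1 < q.1 ∧ q.1 ≤ u q.2.2}
  have hW : MeasurableSet W :=
    by
    simp only [W, ofPred_and]
    exact (measurableSet_lt (by fun_prop) (by fun_prop)).inter
      (measurableSet_le (by fun_prop) (by fun_prop))
  let g : ℝ × (Euc n × Euc n) → ℝ≥0∞ := W.indicator fun q => k (q.2.1 - q.2.2)
  have hg : AEMeasurable g ((volume.restrict (Ioo a b)).prod ν) :=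
    (AEMeasurable.comp_snd (f := fun p : Euc n × Euc n => k (p.1 - p.2))
      hk.aemeasurable_sub.restrict).indicator hW
  have h1 : ∀ s, wint k (X ∩ {x | u x < s}) (Y \ {x | u x < s}) = ∫⁻ p, g (s, p) ∂ν := by
    intro s
    have hWs : MeasurableSet {p : Euc n × Euc n | u p.1 < s ∧ s ≤ u p.2} := by
      rw [ofPred_and]
      exact (measurableSet_lt (by fun_prop) (by fun_prop)).inter
        (measurableSet_le (by fun_prop) (by fun_prop))
    have : (X ∩ {x | u x < s}) ×ˢ (Y \ {x | u x < s}) =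
        {p : Euc n × Euc n | u p.1 < s ∧ s ≤ u p.2} ∩ X ×ˢ Y := by
      ext p; simp only [mem_prod, mem_inter_iff, mem_ofPred_eq, Set.mem_sdiff, not_lt]; tauto
    rw [wint_eq_setLIntegral_prod hk, this, ← Measure.restrict_restrict hWs,
      ← lintegral_indicator hWs]
    rfl
  simp_rw [h1]
  refine ⟨hg.lintegral_prod_right', ?_⟩
  rw [lintegral_lintegral_swap (f := fun s p => g (s, p)) hg]
  have hV : MeasurableSet {p : Euc n × Euc n | u p.1 < b ∧ a < u p.2} := by
      rw [ofPred_and]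
      exact (measurableSet_lt (by fun_prop) (by fun_prop)).inter
        (measurableSet_lt (by fun_prop) (by fun_prop))
  have : (X ∩ {x | u x < b}) ×ˢ (Y \ {x | u x ≤ a}) =
      {p : Euc n × Euc n | u p.1 < b ∧ a < u p.2} ∩ X ×ˢ Y := by
    ext p; simp only [mem_prod, mem_inter_iff, mem_ofPred_eq, Set.mem_sdiff, not_le]; tauto
  rw [wint_eq_setLIntegral_prod hk', this, ← Measure.restrict_restrict hV,
    ← lintegral_indicator hV]
  refine lintegral_mono fun p => ?_
  have h2 : ∀ s, g (s, p) = (Ioc (u p.1) (u p.2)).indicator (fun _ => k (p.1 - p.2)) s := by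
    intro s; rfl
  simp_rw [h2]
  rw [lintegral_indicator measurableSet_Ioc, setLIntegral_const,
    Measure.restrict_apply measurableSet_Ioc]
  by_cases hp : u p.1 < b ∧ a < u p.2
  · rw [indicator_of_mem (by exact hp), mul_comm]
    gcongr
    have hl : u p.2 - u p.1 ≤ ‖p.1 - p.2‖ := by
      have := hu.dist_le_mul p.2 p.1
      rw [NNReal.coe_one, one_mul, dist_comm p.2, dist_eq_norm p.1, Real.dist_eq] at this
      exact (le_abs_self _).trans this
    rw [ENNReal.ofReal_min]
    refine le_min ?_ ?_
    · exact (measure_mono inter_subset_right).trans_eq Real.volume_Ioo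
    · refine (measure_mono inter_subset_left).trans (Real.volume_Ioc.trans_le ?_)
      exact ENNReal.ofReal_le_ofReal hl
  · rw [indicator_of_notMem (by exact hp)]
    have : Ioc (u p.1) (u p.2) ∩ Ioo a b = ∅ := by
      ext s
      simp only [mem_inter_iff, mem_Ioc, mem_Ioo, mem_empty_iff_false, iff_false]
      rintro ⟨⟨h1, h2⟩, h3, h4⟩
      exact hp ⟨h1.trans h4, h3.trans_le h2⟩
    simp [this]

/-- Cutting along a generic level set of a `1`-Lipschitz function costs little interaction. -/
theorem exists_wint_level_le (hk : IsWeight k) {u : Euc n → ℝ} (hu : LipschitzWith 1 u)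
    {a b : ℝ} (hab : a < b) (X Y : Set (Euc n)) :
    ∃ s ∈ Ioo a b, wint k (X ∩ {x | u x < s}) (Y \ {x | u x < s}) ≤
      wint (fun z => ENNReal.ofReal (min (b - a) ‖z‖) * k z)
        (X ∩ {x | u x < b}) (Y \ {x | u x ≤ a}) / ENNReal.ofReal (b - a) := by
  have hD : ENNReal.ofReal (b - a) ≠ 0 := by simpa using hab
  by_contra! hcon
  set c := wint (fun z => ENNReal.ofReal (min (b - a) ‖z‖) * k z)
        (X ∩ {x | u x < b}) (Y \ {x | u x ≤ a})
  have hc : c ≠ ∞ := by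
    rintro h
    obtain ⟨s, hs⟩ : (Ioo a b).Nonempty := nonempty_Ioo.2 hab
    have := hcon s hs
    rw [h, ENNReal.top_div_of_ne_top ENNReal.ofReal_ne_top] at this
    exact not_top_lt this
  obtain ⟨h0, h1⟩ := lintegral_wint_level_le hk hu a b X Y
  have h2 : ∫⁻ _ in Ioo a b, c / ENNReal.ofReal (b - a) <
      ∫⁻ s in Ioo a b, wint k (X ∩ {x | u x < s}) (Y \ {x | u x < s}) := by
    refine lintegral_strict_mono ?_ h0 ?_ ?_
    · simp [hab]
    · rw [setLIntegral_const, Real.volume_Ioo, ENNReal.div_mul_cancel hD ENNReal.ofReal_ne_top]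
      exact hc
    · exact (ae_restrict_iff' measurableSet_Ioo).2 (ae_of_all _ hcon)
  rw [setLIntegral_const, Real.volume_Ioo, ENNReal.div_mul_cancel hD ENNReal.ofReal_ne_top] at h2
  exact absurd h1 (not_le.2 h2)

end Weight

/-! ### Consequences of strong outward minimality. -/

section OutwardMinimizing

variable {n : ℕ} {k : Euc n → ℝ≥0∞}

theorem CompactlyIn.subset {A Ω : Set (Euc n)} (h : CompactlyIn A Ω) : A ⊆ Ω :=
  subset_closure.trans h.2

theorem CompactlyIn.mono {A B Ω : Set (Euc n)} (h : CompactlyIn B Ω) (hAB : A ⊆ B) :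
    CompactlyIn A Ω :=
  ⟨h.1.of_isClosed_subset isClosed_closure (closure_mono hAB), (closure_mono hAB).trans h.2⟩

theorem CompactlyIn.union {A B Ω : Set (Euc n)} (hA : CompactlyIn A Ω) (hB : CompactlyIn B Ω) :
    CompactlyIn (A ∪ B) Ω := by
  rw [CompactlyIn, closure_union]
  exact ⟨hA.1.union hB.1, union_subset hA.2 hB.2⟩

theorem perKIn_eq_wper {K : Euc n → ℝ} (hk : IsWeight fun x => ENNReal.ofReal (K x))
    {A Ω : Set (Euc n)} (hΩ : IsOpen Ω) (h : A ⊆ Ω) :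
    perKIn K A Ω = wper (fun x => ENNReal.ofReal (K x)) A := by
  have h1 : Aᶜ = (Ω \ A) ∪ Ωᶜ := by
    ext x
    have := @h x
    simp only [mem_compl_iff, mem_union, Set.mem_sdiff]; tauto
  have h2 : Disjoint (Ω \ A) Ωᶜ := by
    rw [Set.disjoint_left]; rintro x ⟨h3, _⟩ h4; exact h4 h3
  rw [perKIn, inter_eq_left.2 h, union_eq_left.2 h, wper, h1,
    wint_union_right hk _ _ hΩ.measurableSet.compl.nullMeasurableSet h2]
  rfl

/-- Strongly outward minimizing sets, in terms of the full perimeter. -/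
def OutMin (k : Euc n → ℝ≥0∞) (Ω A : Set (Euc n)) (δ : ℝ≥0∞) : Prop :=
  ∀ G : Set (Euc n), NullMeasurableSet G volume → A ⊆ G → CompactlyIn G Ω →
    wper k A + δ * volume (G \ A) ≤ wper k G

theorem StronglyOutwardMinimizing.outMin {K : Euc n → ℝ}
    (hk : IsWeight fun x => ENNReal.ofReal (K x)) {A Ω : Set (Euc n)} (hΩ : IsOpen Ω)
    (h : A ⊆ Ω) {δ : ℝ} (hA : StronglyOutwardMinimizing K Ω A δ) :
    OutMin (fun x => ENNReal.ofReal (K x)) Ω A (ENNReal.ofReal δ) := by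
  intro G hG hAG hGΩ
  have := hA G hG hAG (hGΩ.mono sdiff_subset)
  rwa [perKIn_eq_wper hk hΩ h, perKIn_eq_wper hk hΩ hGΩ.subset] at this

/-- Every point of the closure of `A` has distance at least `R` from the complement of `Ω`. -/
def FarFromCompl (A Ω : Set (Euc n)) (R : ℝ) : Prop :=
  ∀ y ∈ closure A, ∀ x, x ∉ Ω → R ≤ dist x y

theorem FarFromCompl.mono {A B Ω : Set (Euc n)} {R : ℝ} (h : FarFromCompl B Ω R) (hAB : A ⊆ B) :
    FarFromCompl A Ω R := fun y hy => h y (closure_mono hAB hy)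

theorem exists_mem_frontier_segment {A : Set (Euc n)} {x y : Euc n} (hx : x ∈ A) (hy : y ∉ A) :
    ∃ z ∈ segment ℝ x y, z ∈ frontier A := by
  have hc : IsPreconnected (segment ℝ x y) := (convex_segment x y).isPreconnected
  by_contra! hcon
  have := isPreconnected_iff_subset_of_disjoint.1 hc (interior A) (closure A)ᶜ isOpen_interior
    isClosed_closure.isOpen_compl ?_ ?_
  · rcases this with h | h
    · exact hy (interior_subset (h (right_mem_segment ℝ x y)))
    · exact h (left_mem_segment ℝ x y) (subset_closure hx)
  · intro z hz
    have := hcon z hz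
    rw [frontier, Set.mem_sdiff] at this
    simp only [mem_union, mem_compl_iff]; tauto
  · ext z
    simp only [mem_inter_iff, mem_compl_iff, mem_empty_iff_false, iff_false]
    rintro ⟨_, h1, h2⟩
    exact h2 (interior_subset_closure h1)

/-- The segment from y to x meets ∂Ω at some b, and the segment from y to b meets ∂A at some a. So
the distance between boundaries controls the distance from the closure of A to the complement of Ω.
-/
theorem bdryDist_le_edist {A Ω : Set (Euc n)} (hΩ : IsOpen Ω) (hA : CompactlyIn A Ω) {x y : Euc n}
    (hy : y ∈ closure A) (hx : x ∉ Ω) : bdryDist A Ω ≤ edist x y := by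
  obtain ⟨b, hb, hbΩ⟩ := exists_mem_frontier_segment (hA.2 hy) hx
  have hbΩ' : b ∉ Ω := by
    rw [hΩ.frontier_eq] at hbΩ
    exact hbΩ.2
  obtain ⟨a, ha, haA⟩ := exists_mem_frontier_segment (A := closure A) hy (fun h => hbΩ' (hA.2 h))
  have h1 : dist a b ≤ dist y b :=
    (convex_closedBall b (dist y b)).segment_subset (Metric.mem_closedBall.2 le_rfl)
      (Metric.mem_closedBall_self dist_nonneg) ha
  have h2 : dist b y ≤ dist x y :=
    (convex_closedBall y (dist x y)).segment_subset (Metric.mem_closedBall_self dist_nonneg)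
      (Metric.mem_closedBall.2 le_rfl) hb
  calc bdryDist A Ω ≤ edist a b :=
        (iInf₂_le a (frontier_closure_subset haA)).trans (iInf₂_le b hbΩ)
    _ ≤ edist x y := by
        rw [edist_dist, edist_dist]
        exact ENNReal.ofReal_le_ofReal (h1.trans (by rwa [dist_comm y b]))

theorem farFromCompl_of_le_bdryDist {A Ω : Set (Euc n)} (hΩ : IsOpen Ω) (hA : CompactlyIn A Ω) {R : ℝ}
    (hR : ENNReal.ofReal R ≤ bdryDist A Ω) : FarFromCompl A Ω R := by
  intro y hy x hx
  have := hR.trans (bdryDist_le_edist hΩ hA hy hx)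
  rw [edist_dist] at this
  exact (ENNReal.ofReal_le_ofReal_iff dist_nonneg).1 this

theorem compactlyIn_nhd {A Ω : Set (Euc n)} (hA : CompactlyIn A Ω) (hne : A.Nonempty) {R s : ℝ}
    (hR : FarFromCompl A Ω R) (hs : s < R) : CompactlyIn {x | Metric.infDist x A < s} Ω := by
  have hsub : closure {x | Metric.infDist x A < s} ⊆ {x | Metric.infDist x A ≤ s} :=
    closure_minimal (ofPred_subset_ofPred.2 fun x hx => le_of_lt hx)
      (isClosed_le (Metric.continuous_infDist_pt A) continuous_const)
  have hnear : ∀ x, Metric.infDist x A ≤ s → ∃ y ∈ closure A, dist x y ≤ s := by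
    intro x hx
    obtain ⟨y, hy, h⟩ := hA.1.exists_infDist_eq_dist hne.closure x
    rw [Metric.infDist_closure] at h
    exact ⟨y, hy, h ▸ hx⟩
  refine ⟨Metric.isCompact_of_isClosed_isBounded isClosed_closure ?_, ?_⟩
  · obtain ⟨M, hM⟩ := hA.1.isBounded.exists_norm_le
    refine (isBounded_iff_forall_norm_le).2 ⟨M + s, fun x hx => ?_⟩
    obtain ⟨y, hy, h⟩ := hnear x (hsub hx)
    have h1 := hM y hy
    have : ‖x‖ ≤ ‖y‖ + dist x y := by rw [dist_eq_norm]; exact norm_le_insert' x y |>.trans le_rfl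
    linarith
  · intro x hx
    by_contra hxΩ
    obtain ⟨y, hy, h⟩ := hnear x (hsub hx)
    linarith [hR y hy x hxΩ]

/-- The standing properties of a set in a discrete flow. -/
structure Admissible (k : Euc n → ℝ≥0∞) (Ω : Set (Euc n)) (δ : ℝ≥0∞) (R : ℝ) (A : Set (Euc n)) :
    Prop where
  nullMeasurable : NullMeasurableSet A volume
  compactlyIn : CompactlyIn A Ω
  far : FarFromCompl A Ω R
  outMin : OutMin k Ω A δ

theorem volume_ne_top_of_compactlyIn {A Ω : Set (Euc n)} (hA : CompactlyIn A Ω) :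
    volume A ≠ ∞ :=
  ((measure_mono subset_closure).trans_lt hA.1.measure_lt_top).ne

theorem wper_empty : wper k ∅ = 0 := by simp [wper, wint]

theorem lintegral_min_mul_ne_top (hk1 : ∫⁻ z, ENNReal.ofReal (min 1 ‖z‖) * k z ≠ ∞) (D : ℝ) : ∫⁻ z, ENNReal.ofReal (min D ‖z‖) * k z ≠ ∞ := by
  have h : ∀ z : Euc n, ENNReal.ofReal (min D ‖z‖) * k z ≤
      ENNReal.ofReal (max 1 D) * (ENNReal.ofReal (min 1 ‖z‖) * k z) := by
    intro z
    rw [← mul_assoc, ← ENNReal.ofReal_mul (by positivity)]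
    gcongr
    rcases le_total 1 ‖z‖ with h1 | h1
    · rw [min_eq_left h1, mul_one]
      exact (min_le_left _ _).trans (le_max_right _ _)
    · rw [min_eq_right h1]
      have h2 := le_max_left 1 D
      have h3 := min_le_right D ‖z‖
      nlinarith [norm_nonneg z]
  refine ne_top_of_le_ne_top ?_ (lintegral_mono h)
  rw [lintegral_const_mul' _ _ ENNReal.ofReal_ne_top]
  exact ENNReal.mul_ne_top ENNReal.ofReal_ne_top hk1

/-- A generic neighbourhood {dist(·, A) < s} has finite perimeter by the coarea inequality, and it
is an admissible outer competitor. Finiteness allows Per(A) to be cancelled later. -/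
theorem Admissible.wper_ne_top (hk : IsWeight k)
    (hk1 : ∫⁻ z, ENNReal.ofReal (min 1 ‖z‖) * k z ≠ ∞) {Ω A : Set (Euc n)} {δ : ℝ≥0∞} {R : ℝ}
    (hR : 0 < R) (hA : Admissible k Ω δ R A) : wper k A ≠ ∞ := by
  rcases A.eq_empty_or_nonempty with rfl | hne
  · simp [wper_empty]
  obtain ⟨s, ⟨hs0, hs⟩, hle⟩ := exists_wint_level_le hk (Metric.lipschitz_infDist_pt A)
    (half_pos hR) univ univ
  have hc1 := compactlyIn_nhd hA.compactlyIn hne hA.far (half_lt_self hR)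
  have hc2 := compactlyIn_nhd hA.compactlyIn hne hA.far (hs.trans (half_lt_self hR))
  have hsub : A ⊆ {x | Metric.infDist x A < s} := fun x hx => by
    rw [mem_ofPred_eq, Metric.infDist_zero_of_mem hx]
    exact hs0
  have hm : NullMeasurableSet {x | Metric.infDist x A < s} volume :=
    (measurableSet_lt (by fun_prop) (by fun_prop)).nullMeasurableSet
  refine ne_top_of_le_ne_top ?_ ((le_self_add.trans (hA.outMin _ hm hsub hc2)))
  rw [univ_inter, ← compl_eq_univ_sdiff, univ_inter] at hle
  refine ne_top_of_le_ne_top (ENNReal.div_ne_top ?_ (by simpa using hR)) hle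
  exact ne_top_of_le_ne_top (ENNReal.mul_ne_top (lintegral_min_mul_ne_top hk1 _)
    (volume_ne_top_of_compactlyIn hc1)) (wint_le_mul_volume_left _ _)

/-- Test outward minimality with G ∪ A and add submodularity; the finite number Per(A) cancels. -/
theorem Admissible.wper_inter_add_le (hk : IsWeight k)
    (hk1 : ∫⁻ z, ENNReal.ofReal (min 1 ‖z‖) * k z ≠ ∞) {Ω A : Set (Euc n)} {δ : ℝ≥0∞} {R : ℝ}
    (hR : 0 < R) (hA : Admissible k Ω δ R A) {G : Set (Euc n)} (hG : NullMeasurableSet G volume)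
    (hGΩ : CompactlyIn G Ω) : wper k (G ∩ A) + δ * volume (G \ A) ≤ wper k G := by
  have h1 := wper_inter_add_wper_union_le hk hG hA.nullMeasurable
  have h2 := hA.outMin (G ∪ A) (hG.union hA.nullMeasurable) subset_union_right
    (hGΩ.union hA.compactlyIn)
  rw [union_sdiff_right] at h2
  have h3 := hA.wper_ne_top hk hk1 hR
  refine (ENNReal.add_le_add_iff_right h3).1 ?_
  calc _ = wper k (G ∩ A) + (wper k A + δ * volume (G \ A)) := by ring
    _ ≤ _ := (add_le_add_right h2 _).trans h1

/-- Apply the preceding inequality to G + v, which is still compactly inside Ω because G ⊆ A and |v|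
< R, and translate back. -/
theorem Admissible.wper_inter_translate_add_le (hk : IsWeight k)
    (hk1 : ∫⁻ z, ENNReal.ofReal (min 1 ‖z‖) * k z ≠ ∞) {Ω A : Set (Euc n)} {δ : ℝ≥0∞} {R : ℝ}
    (hR : 0 < R) (hA : Admissible k Ω δ R A) {G : Set (Euc n)} (hG : NullMeasurableSet G volume)
    (hGA : G ⊆ A) {v : Euc n} (hv : ‖v‖ < R) :
    wper k (G ∩ (fun x => x + v) ⁻¹' A) + δ * volume (G \ (fun x => x + v) ⁻¹' A) ≤
      wper k G := by
  set G' : Set (Euc n) := (fun x => x + -v) ⁻¹' G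
  have hpre : ∀ T : Set (Euc n), (fun x => x + v) ⁻¹' ((fun x => x + -v) ⁻¹' T) = T := by
    intro T; ext x; simp
  have hG' : NullMeasurableSet G' volume :=
    hG.preimage (measurePreserving_add_right volume (-v)).quasiMeasurePreserving
  have hcl : closure G' ⊆ (fun x => x + v) '' closure A := by
    have hcomp := (hA.compactlyIn.1.image (continuous_add_const v)).isClosed
    refine closure_minimal (fun x hx => ?_) hcomp
    exact ⟨x + -v, subset_closure (hGA hx), by simp⟩
  have hG'Ω : CompactlyIn G' Ω := by
    refine ⟨(hA.compactlyIn.1.image (continuous_add_const v)).of_isClosed_subset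
      isClosed_closure hcl, fun x hx => ?_⟩
    obtain ⟨y, hy, rfl⟩ := hcl hx
    by_contra hcon
    have := hA.far y hy _ hcon
    rw [dist_eq_norm, add_sub_cancel_left] at this
    linarith
  have := hA.wper_inter_add_le hk hk1 hR hG' hG'Ω
  rw [← wper_translate v (G' ∩ A), ← wper_translate v G',
    ← measure_preimage_add_right volume v (G' \ A), preimage_inter, preimage_sdiff, hpre] at this
  exact this

end OutwardMinimizing

/-! ### One minimization step: confinement of the minimizer. -/

section Step

variable {n : ℕ} {K : Euc n → ℝ} {h r : ℝ} {E F : Set (Euc n)}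

theorem signedDist_of_mem {x : Euc n} (hx : x ∈ E) : signedDist E x = Metric.infDist x Eᶜ := by
  rw [signedDist, Metric.infDist_zero_of_mem hx, sub_zero]

theorem signedDist_of_notMem {x : Euc n} (hx : x ∉ E) : signedDist E x = -Metric.infDist x E := by
  rw [signedDist, Metric.infDist_zero_of_mem (mem_compl hx), zero_sub]

theorem ofReal_signedDist_of_notMem {x : Euc n} (hx : x ∉ E) :
    ENNReal.ofReal (signedDist E x) = 0 := by
  rw [signedDist_of_notMem hx, ENNReal.ofReal_eq_zero]
  exact neg_nonpos.2 Metric.infDist_nonneg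

theorem ofReal_neg_signedDist_of_mem {x : Euc n} (hx : x ∈ E) :
    ENNReal.ofReal (-signedDist E x) = 0 := by
  rw [signedDist_of_mem hx, ENNReal.ofReal_eq_zero]
  exact neg_nonpos.2 Metric.infDist_nonneg

theorem lintegral_signedDist_ne_top (hE : Bornology.IsBounded E) (F : Set (Euc n)) :
    ∫⁻ x in F, ENNReal.ofReal (signedDist E x) ≠ ∞ := by
  obtain ⟨M, hM⟩ := hE.exists_norm_le
  have hle : ∀ x, ENNReal.ofReal (signedDist E x) ≤
      (Metric.closedBall (0 : Euc n) M).indicator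
        (fun _ => ENNReal.ofReal (Metric.infDist 0 Eᶜ + M)) x := by
    intro x
    by_cases hx : x ∈ E
    · have hxM := hM x hx
      rw [indicator_of_mem (by simpa using hxM), signedDist_of_mem hx]
      refine ENNReal.ofReal_le_ofReal ?_
      have := Metric.infDist_le_infDist_add_dist (s := Eᶜ) (x := x) (y := 0)
      rw [dist_zero_right] at this
      linarith
    · rw [ofReal_signedDist_of_notMem hx]
      exact zero_le
  refine ne_top_of_le_ne_top ?_ ((setLIntegral_le_lintegral _ _).trans (lintegral_mono hle))
  rw [lintegral_indicator measurableSet_closedBall, setLIntegral_const]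
  exact ENNReal.mul_ne_top ENNReal.ofReal_ne_top measure_closedBall_lt_top.ne

/-- Moves the finite subtracted terms of two energies across the inequality, so that all later
comparisons take place in `ℝ≥0∞`. -/
theorem add_le_add_of_ereal_sub_le_sub {a b c d : ℝ≥0∞} (hb : b ≠ ∞) (hd : d ≠ ∞)
    (hle : (a : EReal) - b ≤ (c : EReal) - d) : a + d ≤ c + b := by
  lift b to ℝ≥0 using hb
  lift d to ℝ≥0 using hd
  rcases eq_or_ne c ∞ with rfl | hc
  · simp
  lift c to ℝ≥0 using hc
  rcases eq_or_ne a ∞ with rfl | ha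
  · exfalso
    have h1 : ((∞ : ℝ≥0∞) : EReal) - ((b : ℝ≥0∞) : EReal) = ⊤ := EReal.top_sub_coe b
    have h2 : ((c : ℝ≥0∞) : EReal) - ((d : ℝ≥0∞) : EReal) = (((c : ℝ) - d : ℝ) : EReal) := rfl
    rw [h1, h2, top_le_iff] at hle
    exact EReal.coe_ne_top _ hle
  lift a to ℝ≥0 using ha
  have h1 : (((a : ℝ) - b : ℝ) : EReal) ≤ (((c : ℝ) - d : ℝ) : EReal) := hle
  rw [EReal.coe_le_coe_iff] at h1
  have h2 : a + d ≤ c + b := by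
    rw [← NNReal.coe_le_coe]; push_cast; linarith
  exact_mod_cast h2

/-- The weight of a real kernel. -/
noncomputable def wt (K : Euc n → ℝ) (x : Euc n) : ℝ≥0∞ := ENNReal.ofReal (K x)

theorem IsMinimizer.add_le (hE : Bornology.IsBounded E) (hF : IsMinimizer K h E F)
    {G : Set (Euc n)} (hG : NullMeasurableSet G volume) :
    wper (wt K) F + ENNReal.ofReal (1 / h) * (∫⁻ x in F, ENNReal.ofReal (-signedDist E x))
        + ENNReal.ofReal (1 / h) * (∫⁻ x in G, ENNReal.ofReal (signedDist E x)) ≤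
      wper (wt K) G + ENNReal.ofReal (1 / h) * (∫⁻ x in G, ENNReal.ofReal (-signedDist E x))
        + ENNReal.ofReal (1 / h) * (∫⁻ x in F, ENNReal.ofReal (signedDist E x)) :=
  add_le_add_of_ereal_sub_le_sub
    (ENNReal.mul_ne_top ENNReal.ofReal_ne_top (lintegral_signedDist_ne_top hE F))
    (ENNReal.mul_ne_top ENNReal.ofReal_ne_top (lintegral_signedDist_ne_top hE G)) (hF.2 G hG)

theorem IsMinimizer.wper_add_ne_top (hE : Bornology.IsBounded E) (hF : IsMinimizer K h E F) :
    wper (wt K) F + ENNReal.ofReal (1 / h) * (∫⁻ x in F, ENNReal.ofReal (-signedDist E x)) ≠ ∞ := by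
  have := hF.add_le hE (G := ∅) nullMeasurableSet_empty
  simp only [wper_empty, Measure.restrict_empty, lintegral_zero_measure, mul_zero, add_zero,
    zero_add] at this
  exact ne_top_of_le_ne_top
    (ENNReal.mul_ne_top ENNReal.ofReal_ne_top (lintegral_signedDist_ne_top hE F)) this

theorem IsMinimizer.congr (hF : IsMinimizer K h E F) {F' : Set (Euc n)}
    (hFF' : F =ᵐ[volume] F') : IsMinimizer K h E F' := by
  refine ⟨hF.1.congr hFF', fun G hG => ?_⟩
  have : energy K h E F' = energy K h E F := by
    have : perK K F' = perK K F := wper_congr (k := wt K) hFF'.symm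
    rw [energy, energy, this, Measure.restrict_congr_set hFF']
  rw [this]
  exact hF.2 G hG

theorem setLIntegral_inter_add_sdiff (f : Euc n → ℝ≥0∞) (A : Set (Euc n)) {B : Set (Euc n)}
    (hB : NullMeasurableSet B volume) :
    (∫⁻ x in A ∩ B, f x) + ∫⁻ x in A \ B, f x = ∫⁻ x in A, f x := by
  rw [← lintegral_add_measure, Measure.restrict_inter_add_sdiff₀ A hB]

theorem lintegral_signedDist_inter (hE : NullMeasurableSet E volume)
    (hF : NullMeasurableSet F volume) :
    ∫⁻ x in F ∩ E, ENNReal.ofReal (signedDist E x) =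
      ∫⁻ x in F, ENNReal.ofReal (signedDist E x) := by
  rw [← setLIntegral_inter_add_sdiff _ F hE]
  have : ∫⁻ x in F \ E, ENNReal.ofReal (signedDist E x) = 0 := by
    refine lintegral_eq_zero_of_ae_eq_zero ?_
    filter_upwards [ae_restrict_mem₀ (hF.diff hE)] with x hx
    exact ofReal_signedDist_of_notMem hx.2
  rw [this, add_zero]

theorem lintegral_neg_signedDist_of_subset (hF : NullMeasurableSet F volume) (hFE : F ⊆ E) :
    ∫⁻ x in F, ENNReal.ofReal (-signedDist E x) = 0 := by
  refine lintegral_eq_zero_of_ae_eq_zero ?_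
  filter_upwards [ae_restrict_mem₀ hF] with x hx
  exact ofReal_neg_signedDist_of_mem (hFE hx)

theorem setLIntegral_ge_mul {f : Euc n → ℝ≥0∞} {c : ℝ≥0∞} {A : Set (Euc n)}
    (hA : NullMeasurableSet A volume) (hf : ∀ᵐ x, x ∈ A → c ≤ f x) :
    c * volume A ≤ ∫⁻ x in A, f x := by
  rw [← setLIntegral_const]
  refine lintegral_mono_ae ?_
  filter_upwards [ae_restrict_mem₀ hA, ae_restrict_of_ae hf] with x hx hx' using hx' hx

theorem setLIntegral_le_mul {f : Euc n → ℝ≥0∞} {c : ℝ≥0∞} {A : Set (Euc n)}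
    (hA : NullMeasurableSet A volume) (hf : ∀ x ∈ A, f x ≤ c) :
    ∫⁻ x in A, f x ≤ c * volume A := by
  rw [← setLIntegral_const]
  refine lintegral_mono_ae ?_
  filter_upwards [ae_restrict_mem₀ hA] with x hx using hf x hx

/-- Cut F at a good distance level s between r/2 and r, so that the outward minimality of E applies
to the bounded part G. The cut costs at most q V, where V is the volume of F beyond distance r/2,
while replacing F by F ∩ E saves a penalty of at least (1/h)(r/2) V. By `hrh` the saving is strictly
larger unless V = 0; then δ|G \ E| ≤ 0 as well. -/
theorem IsMinimizer.volume_sdiff_eq_zero (hk : IsWeight (wt K))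
    (hk1 : ∫⁻ z, ENNReal.ofReal (min 1 ‖z‖) * wt K z ≠ ∞) {Ω : Set (Euc n)} {δ : ℝ≥0∞} {R : ℝ}
    (hE : Admissible (wt K) Ω δ R E) (hne : E.Nonempty) (hδ : δ ≠ 0) (hr : 0 < r) (hrR : r ≤ R)
    (hrh : (∫⁻ z, ENNReal.ofReal (min (r - r / 2) ‖z‖) * wt K z) / ENNReal.ofReal (r - r / 2) <
      ENNReal.ofReal (1 / h) * ENNReal.ofReal (r / 2))
    (hF : IsMinimizer K h E F) : volume (F \ E) = 0 := by
  have hEb : Bornology.IsBounded E := hE.compactlyIn.1.isBounded.subset subset_closure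
  have hR : 0 < R := hr.trans_le hrR
  obtain ⟨s, ⟨hs0, hs⟩, hle⟩ := exists_wint_level_le hk (Metric.lipschitz_infDist_pt E)
    (half_lt_self hr) F F
  have hmlt : ∀ t, NullMeasurableSet {x | Metric.infDist x E < t} volume := fun t =>
    (measurableSet_lt (by fun_prop) (by fun_prop)).nullMeasurableSet
  have hmle : NullMeasurableSet {x | Metric.infDist x E ≤ r / 2} volume :=
    (measurableSet_le (by fun_prop) (by fun_prop)).nullMeasurableSet
  set c := ENNReal.ofReal (1 / h)
  set q := (∫⁻ z, ENNReal.ofReal (min (r - r / 2) ‖z‖) * wt K z) / ENNReal.ofReal (r - r / 2)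
  set V := volume (F \ {x | Metric.infDist x E ≤ r / 2}) with hV
  set G := F ∩ {x | Metric.infDist x E < s}
  have hG : NullMeasurableSet G volume := hF.1.inter (hmlt s)
  have hle' : wint (wt K) G (F \ {x | Metric.infDist x E < s}) ≤ q * V := by
    refine hle.trans ?_
    rw [ENNReal.mul_div_right_comm.symm]
    refine ENNReal.div_le_div_right ?_ _
    exact wint_le_mul_volume_right (hk.mul (by fun_prop) (by simp)) _ _
  have hGE : G ∩ E = F ∩ E := by
    ext x
    simp only [G, mem_inter_iff, mem_ofPred_eq]
    refine ⟨fun hx => ⟨hx.1.1, hx.2⟩, fun hx => ⟨⟨hx.1, ?_⟩, hx.2⟩⟩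
    rw [Metric.infDist_zero_of_mem hx.2]
    linarith
  have hGΩ : CompactlyIn G Ω :=
    (compactlyIn_nhd hE.compactlyIn hne hE.far (hs.trans_le hrR)).mono inter_subset_right
  have ha := hE.wper_inter_add_le hk hk1 hR hG hGΩ
  rw [hGE] at ha
  have hb : wper (wt K) G ≤ wper (wt K) F + q * V := by
    have e : Gᶜ = Fᶜ ∪ (F \ {x | Metric.infDist x E < s}) := by
      ext x
      simp only [G, mem_compl_iff, mem_inter_iff, mem_union, Set.mem_sdiff]; tauto
    rw [wper, e, wint_union_right hk _ _ (hF.1.diff (hmlt s))]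
    · exact add_le_add (wint_mono inter_subset_left subset_rfl) hle'
    · rw [Set.disjoint_left]; rintro x h1 ⟨h2, _⟩; exact h1 h2
  have hneg : ENNReal.ofReal (r / 2) * V ≤ ∫⁻ x in F, ENNReal.ofReal (-signedDist E x) := by
    refine (setLIntegral_ge_mul (hF.1.diff hmle) (ae_of_all _ ?_)).trans
      (lintegral_mono_set sdiff_subset)
    rintro x ⟨_, hx⟩
    rw [mem_ofPred_eq, not_le] at hx
    have hxE : x ∉ E := fun hxE => by
      rw [Metric.infDist_zero_of_mem hxE] at hx
      linarith
    rw [signedDist_of_notMem hxE, neg_neg]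
    exact ENNReal.ofReal_le_ofReal hx.le
  have hfin := hF.wper_add_ne_top hEb
  have hcr : c * ENNReal.ofReal (r / 2) ≠ 0 := (pos_of_gt hrh).ne'
  have hperF : wper (wt K) F ≠ ∞ := ne_top_of_le_ne_top hfin le_self_add
  have hcV : c * ENNReal.ofReal (r / 2) * V ≤
      c * ∫⁻ x in F, ENNReal.ofReal (-signedDist E x) := by
    rw [mul_assoc]
    gcongr
  have hVfin : V ≠ ∞ := by
    intro hVt
    rw [hVt, ENNReal.mul_top hcr, top_le_iff] at hcV
    rw [hcV] at hfin
    simp at hfin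
  have hc := hF.add_le hEb (hF.1.inter hE.nullMeasurable)
  rw [lintegral_signedDist_inter hE.nullMeasurable hF.1, lintegral_neg_signedDist_of_subset
    (hF.1.inter hE.nullMeasurable) inter_subset_right, mul_zero, add_zero,
    ENNReal.add_le_add_iff_right
    (ENNReal.mul_ne_top ENNReal.ofReal_ne_top (lintegral_signedDist_ne_top hEb F))] at hc
  have hfinal : c * ENNReal.ofReal (r / 2) * V + δ * volume (G \ E) ≤ q * V := by
    refine (ENNReal.add_le_add_iff_left hperF).1 ?_
    calc _ = wper (wt K) F + c * ENNReal.ofReal (r / 2) * V + δ * volume (G \ E) := by ring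
      _ ≤ wper (wt K) F + c * (∫⁻ x in F, ENNReal.ofReal (-signedDist E x)) + δ * volume (G \ E) := by
        gcongr
      _ ≤ wper (wt K) (F ∩ E) + δ * volume (G \ E) := by gcongr
      _ ≤ _ := ha.trans hb
  have hV0 : V = 0 := by
    by_contra hV0
    have := (ENNReal.mul_lt_mul_iff_left hV0 hVfin).2 hrh
    exact absurd (le_self_add.trans hfinal) (not_le.2 this)
  rw [hV0, mul_zero, mul_zero, zero_add, nonpos_iff_eq_zero, mul_eq_zero] at hfinal
  refine measure_mono_null ?_ (measure_union_null hV0 (hfinal.resolve_left hδ))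
  rintro x ⟨hxF, hxE⟩
  by_cases hx : Metric.infDist x E ≤ r / 2
  · exact Or.inr ⟨⟨hxF, lt_of_le_of_lt hx hs0⟩, hxE⟩
  · exact Or.inl ⟨hxF, hx⟩

/-- Compare F with F ∩ (E - v). A removed point x has x + v ∉ E, hence depth at most |v| in E, so
the bulk term loses at most |v|/h < δ per unit volume, while the perimeter drops by at least δ per
unit volume. -/
theorem IsMinimizer.volume_sdiff_translate_eq_zero (hk : IsWeight (wt K))
    (hk1 : ∫⁻ z, ENNReal.ofReal (min 1 ‖z‖) * wt K z ≠ ∞) {Ω : Set (Euc n)} {δ : ℝ≥0∞} {R : ℝ}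
    (hE : Admissible (wt K) Ω δ R E) (hF : IsMinimizer K h E F) (hFE : F ⊆ E)
    {v : Euc n} (hv : ‖v‖ < R) (hvδ : ENNReal.ofReal (1 / h) * ENNReal.ofReal ‖v‖ < δ) :
    volume (F \ (fun x => x + v) ⁻¹' E) = 0 := by
  have hEb : Bornology.IsBounded E := hE.compactlyIn.1.isBounded.subset subset_closure
  have hR : 0 < R := (norm_nonneg v).trans_lt hv
  have hEv : NullMeasurableSet ((fun x => x + v) ⁻¹' E) volume :=
    hE.nullMeasurable.preimage (measurePreserving_add_right volume v).quasiMeasurePreserving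
  have h1 := hE.wper_inter_translate_add_le hk hk1 hR hF.1 hFE hv
  set T := F ∩ (fun x => x + v) ⁻¹' E
  have h2 := hF.add_le hEb (hF.1.inter hEv)
  have hfin := ne_top_of_le_ne_top (hF.wper_add_ne_top hEb) le_self_add
  rw [lintegral_neg_signedDist_of_subset hF.1 hFE, lintegral_neg_signedDist_of_subset
    (hF.1.inter hEv) (inter_subset_left.trans hFE), mul_zero, add_zero, add_zero,
    ← setLIntegral_inter_add_sdiff (fun x => ENNReal.ofReal (signedDist E x)) F hEv, mul_add,
    ← add_assoc, add_right_comm, ENNReal.add_le_add_iff_right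
    (ENNReal.mul_ne_top ENNReal.ofReal_ne_top (lintegral_signedDist_ne_top hEb _))] at h2
  have h3 : ∫⁻ x in F \ (fun x => x + v) ⁻¹' E, ENNReal.ofReal (signedDist E x) ≤
      ENNReal.ofReal ‖v‖ * volume (F \ (fun x => x + v) ⁻¹' E) := by
    refine setLIntegral_le_mul (hF.1.diff hEv) ?_
    rintro x ⟨hxF, hx⟩
    rw [signedDist_of_mem (hFE hxF)]
    refine ENNReal.ofReal_le_ofReal ?_
    have := Metric.infDist_le_dist_of_mem (s := Eᶜ) (x := x) (y := x + v) hx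
    simpa [dist_eq_norm] using this
  have hTfin : wper (wt K) T ≠ ∞ := ne_top_of_le_ne_top hfin (le_self_add.trans h1)
  have h4 : δ * volume (F \ (fun x => x + v) ⁻¹' E) ≤
      ENNReal.ofReal (1 / h) * ENNReal.ofReal ‖v‖ * volume (F \ (fun x => x + v) ⁻¹' E) := by
    refine (ENNReal.add_le_add_iff_left hTfin).1 ((h1.trans h2).trans ?_)
    rw [mul_assoc]
    gcongr
  by_contra hne
  have hvfin : volume (F \ (fun x => x + v) ⁻¹' E) ≠ ∞ :=
    ne_top_of_le_ne_top (volume_ne_top_of_compactlyIn hE.compactlyIn)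
      (measure_mono (sdiff_subset.trans hFE))
  exact absurd h4 (not_le.2 ((ENNReal.mul_lt_mul_iff_left hne hvfin).2 hvδ))

end Step

/-! ### Points of density one and null sets under translation. -/

section Density

variable {n : ℕ}

theorem closedBall_ae_eq_ball (x : Euc n) {ρ : ℝ} (hρ : 0 < ρ) :
    Metric.closedBall x ρ =ᵐ[volume] Metric.ball x ρ := by
  rw [← Metric.ball_union_sphere]
  exact union_ae_eq_left_of_ae_eq_empty
    (ae_eq_empty.2 (Measure.addHaar_sphere_of_ne_zero volume x hρ.ne'))

theorem lebesgueRep_congr {A B : Set (Euc n)} (h : A =ᵐ[volume] B) :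
    lebesgueRep A = lebesgueRep B := by
  have : ∀ x r, volume (A ∩ Metric.ball x r) = volume (B ∩ Metric.ball x r) := fun x r =>
    measure_congr (h.inter (ae_eq_refl _))
  simp only [lebesgueRep, this]

theorem lebesgueRep_ae_eq {A : Set (Euc n)} (hA : NullMeasurableSet A volume) :
    lebesgueRep A =ᵐ[volume] A := by
  obtain ⟨B, -, hB, hBA⟩ := hA.exists_measurable_superset_ae_eq
  rw [lebesgueRep_congr hBA.symm]
  refine EventuallyEq.trans ?_ hBA
  filter_upwards [Besicovitch.ae_tendsto_measure_inter_div_of_measurableSet volume hB] with x hx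
  have hx' : Tendsto (fun r : ℝ => volume (B ∩ Metric.ball x r) / volume (Metric.ball x r))
      (𝓝[>] 0) (𝓝 (B.indicator 1 x)) := by
    refine hx.congr' ?_
    filter_upwards [self_mem_nhdsWithin] with r hr
    rw [measure_congr (closedBall_ae_eq_ball x hr),
      measure_congr ((ae_eq_refl B).inter (closedBall_ae_eq_ball x hr))]
  have : x ∈ lebesgueRep B ↔ x ∈ B := by
    by_cases hxB : x ∈ B
    · rw [indicator_of_mem hxB] at hx'
      exact ⟨fun _ => hxB, fun _ => hx'⟩
    · rw [indicator_of_notMem hxB] at hx'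
      refine ⟨fun h => ?_, fun h => absurd h hxB⟩
      exact absurd (tendsto_nhds_unique h hx') (by simp)
  exact propext this

theorem volume_inter_ball_ne_zero {A : Set (Euc n)} {x : Euc n} (hx : x ∈ lebesgueRep A) {ρ : ℝ}
    (hρ : 0 < ρ) : volume (A ∩ Metric.ball x ρ) ≠ 0 := by
  intro h0
  have : Tendsto (fun r : ℝ => volume (A ∩ Metric.ball x r) / volume (Metric.ball x r))
      (𝓝[>] 0) (𝓝 0) := by
    refine tendsto_const_nhds.congr' ?_
    filter_upwards [Ioo_mem_nhdsGT hρ] with r hr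
    rw [measure_mono_null (inter_subset_inter_right _ (Metric.ball_subset_ball hr.2.le)) h0,
      ENNReal.zero_div]
  exact absurd (tendsto_nhds_unique hx this) (by simp)

theorem lebesgueRep_eq_empty_iff {A : Set (Euc n)} (hA : NullMeasurableSet A volume) :
    lebesgueRep A = ∅ ↔ volume A = 0 := by
  constructor
  · intro h
    rw [← measure_congr (lebesgueRep_ae_eq hA), h, measure_empty]
  · intro h
    by_contra hne
    obtain ⟨x, hx⟩ := nonempty_iff_ne_empty.2 hne
    exact volume_inter_ball_ne_zero hx one_pos (measure_mono_null inter_subset_left h)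

/-- The extra hypothesis on the initial set is automatic after one step, since each point of an open
set that A fills up to measure zero has density one. -/
theorem containsFullOpens_lebesgueRep {A : Set (Euc n)} (hA : NullMeasurableSet A volume) :
    ContainsFullOpens (lebesgueRep A) := by
  intro U hU h0 x hx
  have h1 : volume (U \ A) = 0 := by
    rw [← h0]
    exact measure_congr ((ae_eq_refl U).diff (lebesgueRep_ae_eq hA).symm)
  obtain ⟨ε, hε, hball⟩ := Metric.isOpen_iff.1 hU x hx
  refine tendsto_const_nhds.congr' ?_
  filter_upwards [Ioo_mem_nhdsGT hε] with r hr
  have hle : volume (Metric.ball x r) ≤ volume (A ∩ Metric.ball x r) := by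
    rw [← measure_inter_add_sdiff₀ (Metric.ball x r) hA, inter_comm A]
    have h2 : Metric.ball x r \ A ⊆ U \ A :=
      sdiff_subset_sdiff_left ((Metric.ball_subset_ball hr.2.le).trans hball)
    rw [measure_mono_null h2 h1, add_zero]
  rw [le_antisymm (measure_mono inter_subset_right) hle, ENNReal.div_self
    (Metric.measure_ball_pos _ _ hr.1).ne' measure_ball_lt_top.ne]

theorem wint_eq_lintegral_mul_volume {k : Euc n → ℝ≥0∞} (hk : IsWeight k) {A B : Set (Euc n)}
    (hA : NullMeasurableSet A volume) (hB : NullMeasurableSet B volume) :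
    wint k A B = ∫⁻ z, k z * volume (A ∩ (fun x => x + z) ⁻¹' B) := by
  obtain ⟨A', -, hA', hAA⟩ := hA.exists_measurable_superset_ae_eq
  obtain ⟨B', -, hB', hBB⟩ := hB.exists_measurable_superset_ae_eq
  rw [wint_congr hAA.symm hBB.symm]
  have h1 : ∀ z, volume (A ∩ (fun x => x + z) ⁻¹' B) = volume (A' ∩ (fun x => x + z) ⁻¹' B') :=
    fun z => measure_congr (hAA.symm.inter
      ((measurePreserving_add_right volume z).quasiMeasurePreserving.preimage_ae_eq hBB.symm))
  simp_rw [h1]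
  have hS : MeasurableSet {p : Euc n × Euc n | p.1 ∈ A' ∧ p.1 + p.2 ∈ B'} := by
    rw [ofPred_and]
    exact (measurable_fst hA').inter ((measurable_fst.add measurable_snd) hB')
  let g : Euc n → Euc n → ℝ≥0∞ := fun x z =>
    {p : Euc n × Euc n | p.1 ∈ A' ∧ p.1 + p.2 ∈ B'}.indicator (fun p => k p.2) (x, z)
  have hg : AEMeasurable (Function.uncurry g) (volume.prod volume) :=
    (AEMeasurable.comp_snd hk.aemeasurable).indicator hS
  calc wint k A' B' = ∫⁻ x, ∫⁻ z, g x z := by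
        rw [wint, ← lintegral_indicator hA']
        refine lintegral_congr fun x => ?_
        by_cases hx : x ∈ A'
        · rw [indicator_of_mem hx, ← lintegral_indicator hB',
            ← lintegral_add_left_eq_self _ x]
          refine lintegral_congr fun z => ?_
          by_cases hz : x + z ∈ B'
          · rw [indicator_of_mem hz, sub_add_cancel_left, hk.even]
            exact (indicator_of_mem (a := (x, z)) (s := {p : Euc n × Euc n | p.1 ∈ A' ∧ p.1 + p.2 ∈ B'})
              (by exact ⟨hx, hz⟩) (fun p => k p.2)).symm
          · rw [indicator_of_notMem hz]
            exact (indicator_of_notMem (a := (x, z)) (s := {p : Euc n × Euc n | p.1 ∈ A' ∧ p.1 + p.2 ∈ B'})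
              (by exact fun h => hz h.2) (fun p => k p.2)).symm
        · rw [indicator_of_notMem hx]
          symm
          refine lintegral_eq_zero_of_ae_eq_zero (ae_of_all _ fun z => ?_)
          exact (indicator_of_notMem (a := (x, z)) (s := {p : Euc n × Euc n | p.1 ∈ A' ∧ p.1 + p.2 ∈ B'})
              (fun h => hx h.1) (fun p => k p.2))
    _ = ∫⁻ z, ∫⁻ x, g x z := lintegral_lintegral_swap hg
    _ = _ := by
        refine lintegral_congr fun z => ?_
        have hm : MeasurableSet (A' ∩ (fun x => x + z) ⁻¹' B') :=
          hA'.inter (measurable_add_const z hB')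
        rw [← setLIntegral_const, ← lintegral_indicator hm]
        rfl

theorem isWeight_indicator_ball (ρ : ℝ) :
    IsWeight ((Metric.ball (0 : Euc n) ρ).indicator fun _ => (1 : ℝ≥0∞)) :=
  ⟨(measurable_const.indicator measurableSet_ball).aemeasurable, fun x => by
    simp only [indicator, mem_ball_zero_iff, norm_neg]⟩

open scoped Pointwise in
-- If the difference had positive measure for w, a compact κ inside it, shifted by a small w - w'
-- with w' in D, would still overlap κ in positive measure. That overlap lies in the null set
-- belonging to w'.
theorem volume_sdiff_translate_eq_zero_of_dense {S E D : Set (Euc n)} {ρ : ℝ}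
    (hS : NullMeasurableSet S volume) (hE : NullMeasurableSet E volume)
    (hD : Metric.ball (0 : Euc n) ρ ⊆ closure D)
    (h : ∀ w ∈ D, volume (S \ (fun x => x + w) ⁻¹' E) = 0) {w : Euc n}
    (hw : w ∈ Metric.ball (0 : Euc n) ρ) : volume (S \ (fun x => x + w) ⁻¹' E) = 0 := by
  by_contra hne
  have hm : NullMeasurableSet (S \ (fun x => x + w) ⁻¹' E) volume :=
    hS.diff (hE.preimage (measurePreserving_add_right volume w).quasiMeasurePreserving)
  obtain ⟨T, hTs, hT, hTe⟩ := hm.exists_measurable_subset_ae_eq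
  obtain ⟨κ, hκT, hκ, hpos⟩ := hT.exists_lt_isCompact
    (pos_iff_ne_zero.2 (by rwa [measure_congr hTe]) : 0 < volume T)
  have ht := tendsto_measure_vadd_sdiff_isCompact_isClosed (μ := (volume : Measure (Euc n))) hκ
    hκ.isClosed
  have hev : ∀ᶠ u : Euc n in 𝓝 0, volume ((u +ᵥ κ) \ κ) < volume κ := ht.eventually_lt_const hpos
  obtain ⟨ε, hε, hball⟩ := Metric.eventually_nhds_iff.1 hev
  obtain ⟨w', hw', hdist⟩ := Metric.mem_closure_iff.1 (hD hw) ε hε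
  have hlt : volume (((w - w') +ᵥ κ) \ κ) < volume κ := by
    apply hball
    rwa [dist_zero_right, ← dist_eq_norm]
  have h1 := h w' hw'
  have h2 : volume (((w - w') +ᵥ κ) ∩ κ) = 0 := by
    refine measure_mono_null ?_ h1
    rintro y ⟨hy, hyκ⟩
    obtain ⟨x, hx, rfl⟩ := mem_vadd_set.1 hy
    refine ⟨(hTs (hκT hyκ)).1, fun hE => (hTs (hκT hx)).2 ?_⟩
    have e : ((w - w') +ᵥ x) + w' = x + w := by rw [vadd_eq_add]; abel
    rwa [mem_preimage, e] at hE
  have h3 := measure_inter_add_sdiff ((w - w') +ᵥ κ) hκ.measurableSet (μ := volume)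
  rw [h2, zero_add, measure_vadd] at h3
  exact hlt.ne h3

/-- Fubini with the indicator of a ball as weight: for almost every y outside E, the ball of radius
ρ about y meets S in a null set. This fails for every y closer than ρ to a density point of S, so E
has full measure in the open ρ-neighbourhood of the density points and therefore contains it. -/
theorem ball_subset_of_volume_sdiff_translate {S E D : Set (Euc n)} {ρ : ℝ}
    (hS : NullMeasurableSet S volume) (hE : NullMeasurableSet E volume)
    (hEo : ContainsFullOpens E) (hD : Metric.ball (0 : Euc n) ρ ⊆ closure D)
    (h : ∀ w ∈ D, volume (S \ (fun x => x + w) ⁻¹' E) = 0) {p : Euc n}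
    (hp : p ∈ lebesgueRep S) : Metric.ball p ρ ⊆ E := by
  have h1 := fun w hw => volume_sdiff_translate_eq_zero_of_dense hS hE hD h (w := w) hw
  have hk := isWeight_indicator_ball (n := n) ρ
  set k := (Metric.ball (0 : Euc n) ρ).indicator fun _ => (1 : ℝ≥0∞)
  have h2 : wint k Eᶜ S = 0 := by
    rw [wint_comm hk, wint_eq_lintegral_mul_volume hk hS hE.compl]
    refine lintegral_eq_zero_of_ae_eq_zero (ae_of_all _ fun z => ?_)
    by_cases hz : z ∈ Metric.ball (0 : Euc n) ρ
    · have := h1 z hz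
      rw [sdiff_eq, ← preimage_compl] at this
      change k z * _ = 0
      rw [this, mul_zero]
    · simp [k, indicator_of_notMem hz]
  rw [wint, lintegral_eq_zero_iff' (hk.aemeasurable_inner _ _),
    Filter.EventuallyEq, ae_restrict_iff'₀ hE.compl] at h2
  have h3 : volume (Metric.thickening ρ (lebesgueRep S) \ E) = 0 := by
    refine measure_mono_null ?_ h2
    rintro y ⟨hy, hyE⟩ hcon
    obtain ⟨q, hq, hyq⟩ := Metric.mem_thickening_iff.1 hy
    have h4 := hcon hyE
    have h5 : ∀ x, k (y - x) = (Metric.ball y ρ).indicator (fun _ => (1 : ℝ≥0∞)) x := by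
      intro x
      simp only [k, indicator, Metric.mem_ball, dist_zero_right, dist_comm x y, dist_eq_norm y]
    simp only [h5, Pi.zero_apply] at h4
    rw [lintegral_indicator measurableSet_ball, setLIntegral_const, one_mul,
      Measure.restrict_apply measurableSet_ball] at h4
    rw [dist_comm] at hyq
    refine volume_inter_ball_ne_zero hq (sub_pos.2 hyq) (measure_mono_null ?_ h4)
    rintro x ⟨hxS, hx⟩
    refine ⟨?_, hxS⟩
    rw [Metric.mem_ball] at hx ⊢
    linarith [dist_triangle x q y]
  exact (Metric.ball_subset_thickening hp ρ).trans (hEo _ Metric.isOpen_thickening h3)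

end Density

/-! ### Persistence of outward minimality along the flow. -/

section Flow

variable {n : ℕ} {K : Euc n → ℝ}

theorem nontrivial_euc (hn : 1 ≤ n) : Nontrivial (Euc n) := by
  have : Nonempty (Fin n) := ⟨⟨0, hn⟩⟩
  infer_instance

theorem compl_nonempty_of_isBounded (hn : 1 ≤ n) {E : Set (Euc n)} (hE : Bornology.IsBounded E) :
    Eᶜ.Nonempty := by
  have := nontrivial_euc hn
  have : NoncompactSpace (Euc n) := NormedSpace.noncompactSpace ℝ (Euc n)
  refine nonempty_iff_ne_empty.2 fun h => ?_
  rw [compl_empty_iff] at h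
  subst h
  exact noncompact_univ (Euc n) (by
    simpa using Metric.isCompact_of_isClosed_isBounded isClosed_univ hE)

/-- A sequence in a ball around the origin with dense range. -/
theorem exists_seq_dense_ball (n : ℕ) {ρ : ℝ} (hρ : 0 < ρ) :
    ∃ w : ℕ → Euc n, (∀ i, ‖w i‖ < ρ) ∧ Metric.ball (0 : Euc n) ρ ⊆ closure (range w) := by
  classical
  refine ⟨fun i => if ‖TopologicalSpace.denseSeq (Euc n) i‖ < ρ then
    TopologicalSpace.denseSeq (Euc n) i else 0, fun i => ?_, ?_⟩
  · beta_reduce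
    split_ifs with h
    · exact h
    · simpa using hρ
  · refine ((TopologicalSpace.denseRange_denseSeq (Euc n)).open_subset_closure_inter
      Metric.isOpen_ball).trans (closure_mono ?_)
    rintro x ⟨hx, i, rfl⟩
    exact ⟨i, by simpa using fun h => absurd (mem_ball_zero_iff.1 hx) (not_lt.2 h)⟩

/-- Each successive intersection stays inside E, so the translated inequality can be applied
repeatedly and the gains on the disjoint removed pieces add up. -/
theorem wper_inter_iInter_translate_add_le {k : Euc n → ℝ≥0∞} (hk : IsWeight k)
    (hk1 : ∫⁻ z, ENNReal.ofReal (min 1 ‖z‖) * k z ≠ ∞) {Ω E : Set (Euc n)} {δ : ℝ≥0∞} {R : ℝ}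
    (hR : 0 < R) (hE : Admissible k Ω δ R E) {G : Set (Euc n)} (hG : NullMeasurableSet G volume)
    (hGE : G ⊆ E) {w : ℕ → Euc n} (hw : ∀ i, ‖w i‖ < R) (N : ℕ) :
    wper k (G ∩ ⋂ i < N, (fun x => x + w i) ⁻¹' E) +
      δ * volume (G \ ⋂ i < N, (fun x => x + w i) ⁻¹' E) ≤ wper k G := by
  have hm : ∀ i, NullMeasurableSet ((fun x => x + w i) ⁻¹' E) volume := fun i =>
    hE.nullMeasurable.preimage (measurePreserving_add_right volume (w i)).quasiMeasurePreserving
  induction N with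
  | zero => simp
  | succ N ih =>
    have hmN : NullMeasurableSet (⋂ i < N, (fun x => x + w i) ⁻¹' E) volume :=
      NullMeasurableSet.iInter fun i => NullMeasurableSet.iInter fun _ => hm i
    have h1 := hE.wper_inter_translate_add_le hk hk1 hR (hG.inter hmN)
      (inter_subset_left.trans hGE) (hw N)
    have e : (⋂ i < N + 1, (fun x => x + w i) ⁻¹' E) =
        (⋂ i < N, (fun x => x + w i) ⁻¹' E) ∩ (fun x => x + w N) ⁻¹' E :=
      biInter_lt_succ _ _
    set T := ⋂ i < N, (fun x => x + w i) ⁻¹' E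
    rw [e, ← inter_assoc]
    calc _ ≤ wper k (G ∩ T ∩ (fun x => x + w N) ⁻¹' E) +
          δ * (volume (G \ T) + volume ((G ∩ T) \ (fun x => x + w N) ⁻¹' E)) := by
          gcongr
          refine (measure_mono ?_).trans (measure_union_le _ _)
          rintro x ⟨hx, hx'⟩
          by_cases hxT : x ∈ T
          · exact Or.inr ⟨⟨hx, hxT⟩, fun h => hx' ⟨hxT, h⟩⟩
          · exact Or.inl ⟨hx, hxT⟩
      _ = wper k (G ∩ T ∩ (fun x => x + w N) ⁻¹' E) +
          δ * volume ((G ∩ T) \ (fun x => x + w N) ⁻¹' E) + δ * volume (G \ T) := by ring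
      _ ≤ wper k (G ∩ T) + δ * volume (G \ T) := by gcongr
      _ ≤ _ := ih

/-- A competitor G is reduced to G ∩ E and then to its intersection with countably many translates
of E, each reduction gaining δ times the removed volume. What survives, S, has depth at least δh in
E almost everywhere, so minimality of B yields the gain δ|S \ B|. -/
theorem IsMinimizer.outMin (hn : 1 ≤ n) (hk : IsWeight (wt K))
    (hk1 : ∫⁻ z, ENNReal.ofReal (min 1 ‖z‖) * wt K z ≠ ∞) {Ω E B : Set (Euc n)} {δ h R : ℝ}
    (hδ : 0 < δ) (hh : 0 < h) (hδR : δ * h ≤ R) (hE : Admissible (wt K) Ω (ENNReal.ofReal δ) R E)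
    (hEo : ContainsFullOpens E) (hB : IsMinimizer K h E B)
    (hBE : ∀ p ∈ B, Metric.ball p (δ * h) ⊆ E) : OutMin (wt K) Ω B (ENNReal.ofReal δ) := by
  have hEb : Bornology.IsBounded E := hE.compactlyIn.1.isBounded.subset subset_closure
  have hδh : 0 < δ * h := mul_pos hδ hh
  have hR := hδh.trans_le hδR
  obtain ⟨w, hw, hwd⟩ := exists_seq_dense_ball n hδh
  have hBE' : B ⊆ E := fun p hp => hBE p hp (Metric.mem_ball_self hδh)
  have hm : ∀ i, NullMeasurableSet ((fun x => x + w i) ⁻¹' E) volume := fun i =>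
    hE.nullMeasurable.preimage (measurePreserving_add_right volume (w i)).quasiMeasurePreserving
  intro G hG hBG hGΩ
  set T : ℕ → Set (Euc n) := fun N => ⋂ i < N, (fun x => x + w i) ⁻¹' E
  have hT : ∀ N, NullMeasurableSet (T N) volume := fun N =>
    NullMeasurableSet.iInter fun i => NullMeasurableSet.iInter fun _ => hm i
  have hBT : ∀ N, B ⊆ T N := by
    intro N p hp
    simp only [T, mem_iInter]
    intro i _
    exact hBE p hp (by simpa [dist_eq_norm] using hw i)
  set G0 := G ∩ E
  have hG0 : NullMeasurableSet G0 volume := hG.inter hE.nullMeasurable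
  set S := G0 ∩ ⋂ N, T N
  have hS : NullMeasurableSet S volume := hG0.inter (NullMeasurableSet.iInter hT)
  have hdeep : ∀ᵐ x, x ∈ S → ENNReal.ofReal (δ * h) ≤ ENNReal.ofReal (signedDist E x) := by
    filter_upwards [(lebesgueRep_ae_eq hS).mem_iff] with x hx hxS
    have hball := ball_subset_of_volume_sdiff_translate hS hE.nullMeasurable hEo hwd
      (by
        rintro _ ⟨i, rfl⟩
        have : S \ (fun x => x + w i) ⁻¹' E = ∅ := by
          rw [sdiff_eq_empty]
          intro y hy
          exact mem_iInter₂.1 (mem_iInter.1 hy.2 (i + 1)) i (Nat.lt_succ_self i)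
        rw [this, measure_empty]) (hx.2 hxS)
    rw [signedDist_of_mem (hxS.1.2)]
    refine ENNReal.ofReal_le_ofReal ?_
    -- The complement must be nonempty, as `infDist` to the empty set is 0; this is where n ≥ 1
    -- enters.
    refine (Metric.le_infDist (compl_nonempty_of_isBounded hn hEb)).2 fun y hy => ?_
    by_contra hcon
    exact hy (hball (by rw [Metric.mem_ball, dist_comm]; exact not_le.1 hcon))
  have hcδ : ENNReal.ofReal (1 / h) * ENNReal.ofReal (δ * h) = ENNReal.ofReal δ := by
    rw [← ENNReal.ofReal_mul (by positivity)]
    congr 1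
    field_simp
  -- Minimality is used at finite N, so that only a volume has to pass to the limit and no
  -- semicontinuity of the perimeter is needed.
  have key : ∀ N, wper (wt K) B + ENNReal.ofReal δ * volume (S \ B) +
      ENNReal.ofReal δ * volume (G0 \ T N) + ENNReal.ofReal δ * volume (G \ E) ≤
      wper (wt K) G := by
    intro N
    have h1 := hE.wper_inter_add_le hk hk1 hR hG hGΩ
    have h2 := wper_inter_iInter_translate_add_le hk hk1 hR hE hG0 inter_subset_right
      (fun i => (hw i).trans_le hδR) N
    have hGN := hG0.inter (hT N)
    have h3 := hB.add_le hEb hGN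
    rw [lintegral_neg_signedDist_of_subset hB.1 hBE', lintegral_neg_signedDist_of_subset hGN
      (inter_subset_left.trans inter_subset_right), mul_zero, add_zero, add_zero,
      ← setLIntegral_inter_add_sdiff _ (G0 ∩ T N) hB.1,
      inter_eq_self_of_subset_right (subset_inter (subset_inter hBG hBE') (hBT N)), mul_add,
      ← add_assoc, add_right_comm, ENNReal.add_le_add_iff_right
      (ENNReal.mul_ne_top ENNReal.ofReal_ne_top (lintegral_signedDist_ne_top hEb _))] at h3
    have h4 : ENNReal.ofReal δ * volume (S \ B) ≤ ENNReal.ofReal (1 / h) *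
        ∫⁻ x in (G0 ∩ T N) \ B, ENNReal.ofReal (signedDist E x) := by
      rw [← hcδ, mul_assoc]
      gcongr
      refine (setLIntegral_ge_mul (hS.diff hB.1) ?_).trans (lintegral_mono_set
        (sdiff_subset_sdiff_left (inter_subset_inter_right _ (iInter_subset _ N))))
      filter_upwards [hdeep] with x hx hxS using hx hxS.1
    calc _ ≤ wper (wt K) B + ENNReal.ofReal (1 / h) *
          (∫⁻ x in (G0 ∩ T N) \ B, ENNReal.ofReal (signedDist E x)) +
          ENNReal.ofReal δ * volume (G0 \ T N) + ENNReal.ofReal δ * volume (G \ E) := by gcongr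
      _ ≤ wper (wt K) (G0 ∩ T N) + ENNReal.ofReal δ * volume (G0 \ T N) +
          ENNReal.ofReal δ * volume (G \ E) := by gcongr
      _ ≤ wper (wt K) G0 + ENNReal.ofReal δ * volume (G \ E) := by gcongr
      _ ≤ _ := h1
  have hmono : Monotone fun N => G0 \ T N := by
    intro N M hNM
    refine sdiff_subset_sdiff_right ?_
    exact iInter_mono fun i => iInter_mono' fun hi => ⟨hi.trans_le hNM, subset_rfl⟩
  have hlim := tendsto_measure_iUnion_atTop (μ := volume) hmono
  rw [← sdiff_iInter] at hlim
  have hlim' := le_of_tendsto' ((tendsto_const_nhds.add (ENNReal.Tendsto.const_mul hlim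
    (Or.inr ENNReal.ofReal_ne_top))).add tendsto_const_nhds) key
  refine le_trans ?_ hlim'
  rw [add_assoc, add_assoc, ← mul_add, ← mul_add]
  gcongr
  refine (measure_mono (?_ : G \ B ⊆ (S \ B) ∪ ((G0 \ ⋂ N, T N) ∪ (G \ E)))).trans
    ((measure_union_le _ _).trans (add_le_add_right (measure_union_le _ _) _))
  rintro x ⟨hxG, hxB⟩
  by_cases hxE : x ∈ E
  · by_cases hxT : x ∈ ⋂ N, T N
    · exact Or.inl ⟨⟨⟨hxG, hxE⟩, hxT⟩, hxB⟩
    · exact Or.inr (Or.inl ⟨⟨hxG, hxE⟩, hxT⟩)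
  · exact Or.inr (Or.inr ⟨hxG, hxE⟩)

theorem Admissible.step (hn : 1 ≤ n) (hk : IsWeight (wt K))
    (hk1 : ∫⁻ z, ENNReal.ofReal (min 1 ‖z‖) * wt K z ≠ ∞) {Ω E B : Set (Euc n)} {δ h r R : ℝ}
    (hδ : 0 < δ) (hh : 0 < h) (hδR : δ * h ≤ R) (hr : 0 < r) (hrR : r ≤ R)
    (hrh : (∫⁻ z, ENNReal.ofReal (min (r - r / 2) ‖z‖) * wt K z) / ENNReal.ofReal (r - r / 2) <
      ENNReal.ofReal (1 / h) * ENNReal.ofReal (r / 2))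
    (hE : Admissible (wt K) Ω (ENNReal.ofReal δ) R E) (hEo : ContainsFullOpens E)
    (hB : IsStep K h E B) :
    Admissible (wt K) Ω (ENNReal.ofReal δ) R B ∧ ContainsFullOpens B ∧
      ∀ p ∈ B, Metric.ball p (δ * h) ⊆ E := by
  rcases hB with ⟨rfl, rfl⟩ | ⟨hne, hEb, F, hF, rfl⟩
  · exact ⟨hE, hEo, by simp⟩
  have hδ' : ENNReal.ofReal δ ≠ 0 := by simpa using hδ
  have hδh : 0 < δ * h := mul_pos hδ hh
  have h0 := hF.volume_sdiff_eq_zero hk hk1 hE hne hδ' hr hrR hrh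
  have hFE : F =ᵐ[volume] (F ∩ E : Set (Euc n)) := by
    filter_upwards [measure_eq_zero_iff_ae_notMem.1 h0] with x hx
    exact propext ⟨fun h => ⟨h, by_contra fun hxE => hx ⟨h, hxE⟩⟩, fun h => h.1⟩
  have hF1 := hF.congr hFE
  have hball : ∀ p ∈ lebesgueRep F, Metric.ball p (δ * h) ⊆ E := by
    intro p hp
    rw [lebesgueRep_congr hFE] at hp
    refine ball_subset_of_volume_sdiff_translate hF1.1 hE.nullMeasurable hEo subset_closure
      (fun v hv => ?_) hp
    rw [mem_ball_zero_iff] at hv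
    refine hF1.volume_sdiff_translate_eq_zero hk hk1 hE inter_subset_right (hv.trans_le hδR) ?_
    rw [← ENNReal.ofReal_mul (by positivity), ENNReal.ofReal_lt_ofReal_iff hδ,
      one_div_mul_eq_div, div_lt_iff₀ hh]
    exact hv
  have hB : IsMinimizer K h E (lebesgueRep F) := hF.congr (lebesgueRep_ae_eq hF.1).symm
  have hsub : lebesgueRep F ⊆ E := fun p hp => hball p hp (Metric.mem_ball_self hδh)
  exact ⟨⟨hB.1, hE.compactlyIn.mono hsub, hE.far.mono hsub,
    hB.outMin hn hk hk1 hδ hh hδR hE hEo hball⟩, containsFullOpens_lebesgueRep hF.1, hball⟩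

/-- A point closer than ρ to ∂B lies in a ball of radius ρ about some point of B, hence in the
interior of A. -/
theorem le_bdryDist_of_ball_subset {A B : Set (Euc n)} {ρ : ℝ}
    (h : ∀ p ∈ B, Metric.ball p ρ ⊆ A) : ENNReal.ofReal ρ ≤ bdryDist A B := by
  refine le_iInf₂ fun a ha => le_iInf₂ fun b hb => ?_
  rw [edist_dist]
  by_contra hcon
  have hab : dist a b < ρ := by
    by_contra h'
    exact hcon (ENNReal.ofReal_le_ofReal (not_lt.1 h'))
  obtain ⟨p, hp, hbp⟩ := Metric.mem_closure_iff.1 (frontier_subset_closure hb) (ρ - dist a b)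
    (sub_pos.2 hab)
  have : a ∈ interior A := by
    refine interior_mono (h p hp) ?_
    rw [Metric.isOpen_ball.interior_eq, Metric.mem_ball]
    linarith [dist_triangle a b p]
  exact ha.2 this

end Flow

/-! ### Sets with empty interior. -/

section EmptyInterior

variable {n : ℕ} {K : Euc n → ℝ}

theorem ae_ne_zero (hn : 1 ≤ n) : ∀ᵐ x : Euc n, x ≠ 0 := by
  have := nontrivial_euc hn
  exact Measure.ae_ne volume 0

theorem IsKernel.isWeight (hn : 1 ≤ n) (hK : IsKernel K) : IsWeight (wt K) := by
  constructor
  · have h1 : AEMeasurable (fun x : Euc n => (min 1 ‖x‖)⁻¹ * (min 1 ‖x‖ * K x)) volume :=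
      AEMeasurable.mul (by fun_prop) hK.integrable.aestronglyMeasurable.aemeasurable
    refine AEMeasurable.ennreal_ofReal (h1.congr ?_)
    filter_upwards [ae_ne_zero hn] with x hx
    have : min 1 ‖x‖ ≠ 0 := (lt_min one_pos (norm_pos_iff.2 hx)).ne'
    field_simp
  · intro x
    rcases eq_or_ne x 0 with rfl | hx
    · rw [neg_zero]
    · rw [wt, wt, hK.even x hx]

theorem IsKernel.lintegral_ne_top (hK : IsKernel K) :
    ∫⁻ z, ENNReal.ofReal (min 1 ‖z‖) * wt K z ≠ ∞ := by
  have h := hK.integrable.lintegral_lt_top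
  refine ne_of_lt (lt_of_eq_of_lt (lintegral_congr fun z => ?_) h)
  rw [wt, ENNReal.ofReal_mul (le_min zero_le_one (norm_nonneg z))]

theorem volume_sdiff_translate_nsmul_eq_zero {F : Set (Euc n)} {z : Euc n}
    (h : volume (F \ (fun x => x + z) ⁻¹' F) = 0) (m : ℕ) :
    volume (F \ (fun x => x + m • z) ⁻¹' F) = 0 := by
  induction m with
  | zero => simp
  | succ m ih =>
    have h' : volume ((fun x => x + m • z) ⁻¹' (F \ (fun x => x + z) ⁻¹' F)) = 0 := by
      rw [measure_preimage_add_right, h]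
    refine measure_mono_null ?_ (measure_union_null ih h')
    rintro x ⟨hx, hx'⟩
    by_cases hm : x + m • z ∈ F
    · refine Or.inr ⟨hm, fun hm' => hx' ?_⟩
      rw [mem_preimage, succ_nsmul, ← add_assoc]
      exact hm'
    · exact Or.inl ⟨hx, hm⟩

/-- Zero perimeter makes F invariant, up to null sets, under some translation z ≠ 0 in the support
of k. Iterating the translation moves the bounded set F off itself. -/
theorem volume_eq_zero_of_wper_eq_zero (hn : 1 ≤ n) {k : Euc n → ℝ≥0∞} (hk : IsWeight k)
    (hk0 : ¬ k =ᵐ[volume] 0) {F : Set (Euc n)} (hF : NullMeasurableSet F volume)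
    (hFb : Bornology.IsBounded F) (h : wper k F = 0) : volume F = 0 := by
  have hmeas : AEMeasurable (fun z => volume (F ∩ (fun x => x + z) ⁻¹' Fᶜ)) volume := by
    obtain ⟨F', -, hF', hFF⟩ := hF.exists_measurable_superset_ae_eq
    have h1 : ∀ z, volume (F ∩ (fun x => x + z) ⁻¹' Fᶜ) =
        volume (F' ∩ (fun x => x + z) ⁻¹' F'ᶜ) := fun z => measure_congr (hFF.symm.inter
      ((measurePreserving_add_right volume z).quasiMeasurePreserving.preimage_ae_eq
        hFF.symm.compl))
    simp_rw [h1]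
    have hS : MeasurableSet {p : Euc n × Euc n | p.2 ∈ F' ∧ p.2 + p.1 ∈ F'ᶜ} := by
      rw [ofPred_and]
      exact (measurable_snd hF').inter ((measurable_snd.add measurable_fst) hF'.compl)
    exact (measurable_measure_prodMk_left hS).aemeasurable
  rw [wper, wint_eq_lintegral_mul_volume hk hF hF.compl] at h
  replace h := (lintegral_eq_zero_iff' (hk.aemeasurable.mul hmeas)).1 h
  obtain ⟨z, hz, hz0⟩ : ∃ z : Euc n, volume (F \ (fun x => x + z) ⁻¹' F) = 0 ∧ z ≠ 0 := by
    by_contra! hcon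
    refine hk0 ?_
    filter_upwards [h, ae_ne_zero hn] with z hz hz0
    have hz' : k z * volume (F \ (fun x => x + z) ⁻¹' F) = 0 := hz
    exact (mul_eq_zero.1 hz').resolve_right fun h0 => hz0 (hcon z h0)
  obtain ⟨M, hM⟩ := hFb.exists_norm_le
  -- A shift longer than 2M, with F in the ball of radius M, makes F and its translate disjoint.
  obtain ⟨m, hm⟩ := exists_nat_gt (2 * M / ‖z‖)
  rw [div_lt_iff₀ (norm_pos_iff.2 hz0)] at hm
  refine measure_mono_null ?_ (volume_sdiff_translate_nsmul_eq_zero hz m)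
  intro x hx
  refine ⟨hx, fun hx' => ?_⟩
  have h1 := hM _ hx
  have h2 := hM _ hx'
  have h3 : ‖(m : ℝ) • z‖ ≤ ‖x + m • z‖ + ‖x‖ := by
    have : (m : ℝ) • z = (x + m • z) - x := by rw [add_sub_cancel_left, Nat.cast_smul_eq_nsmul]
    rw [this]
    exact norm_sub_le _ _
  rw [norm_smul, Real.norm_natCast] at h3
  linarith

/-- For a vanishing weight outward minimality would force |G \ E| = 0 for an open neighbourhood G of
the closure of E. That closure would then be open, closed, nonempty and bounded, which is
impossible. -/
theorem Admissible.not_ae_eq_zero (hn : 1 ≤ n) {k : Euc n → ℝ≥0∞} {Ω E : Set (Euc n)}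
    {δ : ℝ≥0∞} {R : ℝ} (hR : 0 < R) (hδ : δ ≠ 0) (hE : Admissible k Ω δ R E) (hne : E.Nonempty) :
    ¬ k =ᵐ[volume] 0 := by
  intro hk0
  have hEb : Bornology.IsBounded (closure E) := hE.compactlyIn.1.isBounded
  set G : Set (Euc n) := {x | Metric.infDist x E < R / 2}
  have hGo : IsOpen G := isOpen_lt (Metric.continuous_infDist_pt E) continuous_const
  have hGΩ : CompactlyIn G Ω := compactlyIn_nhd hE.compactlyIn hne hE.far (half_lt_self hR)
  have hEG : closure E ⊆ G := fun x hx => by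
    have : Metric.infDist x E = 0 := (Metric.mem_closure_iff_infDist_zero hne).1 hx
    simp only [G, mem_ofPred_eq, this]
    linarith
  have h1 := hE.outMin G hGo.measurableSet.nullMeasurableSet (subset_closure.trans hEG) hGΩ
  have h2 : wper k G = 0 := by
    refine nonpos_iff_eq_zero.1 ((wint_le_mul_volume_left G Gᶜ).trans ?_)
    rw [lintegral_eq_zero_of_ae_eq_zero hk0, zero_mul]
  rw [h2, nonpos_iff_eq_zero, add_eq_zero, mul_eq_zero] at h1
  have h3 : volume (G \ closure E) = 0 :=
    measure_mono_null (sdiff_subset_sdiff_right subset_closure) (h1.2.resolve_left hδ)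
  have h4 : G \ closure E = ∅ := (hGo.sdiff isClosed_closure).measure_eq_zero_iff volume |>.1 h3
  have h5 : IsClopen (closure E) :=
    ⟨isClosed_closure, by rwa [hEG.antisymm (sdiff_eq_empty.1 h4)]⟩
  rcases isClopen_iff.1 h5 with h6 | h6
  · exact hne.closure.ne_empty h6
  · obtain ⟨x, hx⟩ := compl_nonempty_of_isBounded hn hEb
    rw [h6] at hx
    exact hx (mem_univ x)

theorem ofReal_signedDist_of_interior_eq_empty {E : Set (Euc n)} (hE : interior E = ∅)
    (x : Euc n) : ENNReal.ofReal (signedDist E x) = 0 := by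
  by_cases hx : x ∈ E
  · have : x ∈ closure Eᶜ := by rw [closure_compl, hE, compl_empty]; exact mem_univ x
    rw [signedDist_of_mem hx, Metric.infDist_zero_of_mem_closure this, ENNReal.ofReal_zero]
  · exact ofReal_signedDist_of_notMem hx

theorem isStep_iff_of_interior_eq_empty (hn : 1 ≤ n) (hk : IsWeight (wt K))
    (hk1 : ∫⁻ z, ENNReal.ofReal (min 1 ‖z‖) * wt K z ≠ ∞) {Ω E B : Set (Euc n)} {δ h r R : ℝ}
    (hδ : 0 < δ) (hr : 0 < r) (hrR : r ≤ R)
    (hrh : (∫⁻ z, ENNReal.ofReal (min (r - r / 2) ‖z‖) * wt K z) / ENNReal.ofReal (r - r / 2) <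
      ENNReal.ofReal (1 / h) * ENNReal.ofReal (r / 2))
    (hE : Admissible (wt K) Ω (ENNReal.ofReal δ) R E) (hne : E.Nonempty) (hEi : interior E = ∅) :
    IsStep K h E B ↔ B = ∅ := by
  have hEb : Bornology.IsBounded E := hE.compactlyIn.1.isBounded.subset subset_closure
  have hδ' : ENNReal.ofReal δ ≠ 0 := by simpa using hδ
  constructor
  · rintro (⟨rfl, -⟩ | ⟨-, -, F, hF, rfl⟩)
    · exact absurd rfl hne.ne_empty
    rw [lebesgueRep_eq_empty_iff hF.1]
    have h0 := hF.volume_sdiff_eq_zero hk hk1 hE hne hδ' hr hrR hrh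
    have h1 := hF.add_le hEb (G := ∅) nullMeasurableSet_empty
    simp only [ofReal_signedDist_of_interior_eq_empty hEi, wper_empty, Measure.restrict_empty,
      lintegral_zero_measure, lintegral_zero, mul_zero, add_zero] at h1
    have h2 : wper (wt K) F = 0 := nonpos_iff_eq_zero.1 (le_self_add.trans h1)
    have hFE : F =ᵐ[volume] (F ∩ E : Set (Euc n)) := by
      filter_upwards [measure_eq_zero_iff_ae_notMem.1 h0] with x hx
      exact propext ⟨fun h => ⟨h, by_contra fun hxE => hx ⟨h, hxE⟩⟩, fun h => h.1⟩
    rw [measure_congr hFE]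
    rw [wper_congr hFE] at h2
    exact volume_eq_zero_of_wper_eq_zero hn hk
      (hE.not_ae_eq_zero hn (hr.trans_le hrR) hδ' hne) (hF.1.inter hE.nullMeasurable)
      (hEb.subset inter_subset_right) h2
  · rintro rfl
    refine Or.inr ⟨hne, hEb, ∅, ⟨nullMeasurableSet_empty, fun G _ => ?_⟩, ?_⟩
    · have h1 : perK K ∅ = 0 := wper_empty (k := wt K)
      simp only [energy, h1, ofReal_signedDist_of_interior_eq_empty hEi, Measure.restrict_empty,
        lintegral_zero_measure, lintegral_zero, mul_zero, add_zero, EReal.coe_ennreal_zero,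
        sub_zero]
      exact EReal.coe_ennreal_nonneg _
    · exact ((lebesgueRep_eq_empty_iff nullMeasurableSet_empty).2 measure_empty).symm

end EmptyInterior

/-! ### Tangent paraboloids and balls for C^{1,1} boundaries. -/

section Geometry

variable {n : ℕ}

/-- `F` lies between two paraboloids touching at `x`, with normal `e`. -/
structure IsTrapped (F : Set (Euc n)) (x e : Euc n) (c ρ : ℝ) : Prop where
  norm_eq : ‖e‖ = 1
  pos_const : 0 < c
  pos_radius : 0 < ρ
  mem : ∀ w : Euc n, ‖w‖ < ρ → inner ℝ w e < -(c * ‖w‖ ^ 2) → x + w ∈ interior F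
  notMem : ∀ w : Euc n, ‖w‖ < ρ → c * ‖w‖ ^ 2 < inner ℝ w e → x + w ∉ F

theorem HasCompactC11Boundary.exists_isTrapped {F : Set (Euc n)} (hF : HasCompactC11Boundary F)
    {x : Euc n} (hx : x ∈ frontier F) : ∃ e c ρ, IsTrapped F x e c ρ := by
  obtain ⟨U, φ, C, hU, hxU, hd, hL, h0, hφ⟩ := hF.2 x hx
  have hcont : ContinuousOn φ U := hd.continuousOn
  have hneg : ∀ y ∈ U, φ y < 0 → y ∈ interior F := by
    intro y hy hy0
    have ho : IsOpen (U ∩ φ ⁻¹' Iio 0) := hcont.isOpen_inter_preimage hU isOpen_Iio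
    exact interior_maximal (fun z hz => (hφ z hz.1).1 hz.2) ho ⟨hy, hy0⟩
  have hpos : ¬ 0 < φ x := by
    intro hy0
    have ho : IsOpen (U ∩ φ ⁻¹' Ioi 0) := hcont.isOpen_inter_preimage hU isOpen_Ioi
    obtain ⟨z, hz, hzF⟩ := mem_closure_iff.1 hx.1 _ ho ⟨hxU, hy0⟩
    exact (hφ z hz.1).2 hz.2 hzF
  have hx0 : φ x = 0 := le_antisymm (not_lt.1 hpos) (not_lt.1 fun h => hx.2 (hneg x hxU h))
  set g : Euc n := (InnerProductSpace.toDual ℝ (Euc n)).symm (fderiv ℝ φ x)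
  have hg : ∀ w, inner ℝ w g = fderiv ℝ φ x w := fun w => by
    rw [real_inner_comm]
    exact InnerProductSpace.toDual_symm_apply
  have hgn : 0 < ‖g‖ := by
    rw [norm_pos_iff]
    exact (map_ne_zero_iff _ (LinearIsometryEquiv.injective _)).2 h0
  obtain ⟨ρ, hρ, hball⟩ := Metric.isOpen_iff.1 hU x hxU
  have taylor : ∀ w : Euc n, ‖w‖ < ρ → |φ (x + w) - fderiv ℝ φ x w| ≤ C * ‖w‖ ^ 2 := by
    intro w hw
    have hsub : Metric.closedBall x ‖w‖ ⊆ U :=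
      (Metric.closedBall_subset_ball hw).trans hball
    have := (convex_closedBall x ‖w‖).norm_image_sub_le_of_norm_hasFDerivWithin_le'
      (f := φ) (f' := fderiv ℝ φ) (φ := fderiv ℝ φ x) (C := C * ‖w‖) (x := x) (y := x + w)
      (fun y hy => ((hd.differentiableAt (hU.mem_nhds (hsub hy))).hasFDerivAt).hasFDerivWithinAt)
      (fun y hy => by
        refine (hL.norm_sub_le (hsub hy) hxU).trans ?_
        rw [← dist_eq_norm]
        exact mul_le_mul_of_nonneg_left hy C.2)
      (Metric.mem_closedBall_self (norm_nonneg w)) (by simp)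
    rw [hx0, sub_zero, add_sub_cancel_left, Real.norm_eq_abs] at this
    calc _ ≤ _ := this
      _ = _ := by ring
  have hval : ∀ w : Euc n, inner ℝ w (‖g‖⁻¹ • g) = ‖g‖⁻¹ * fderiv ℝ φ x w := fun w => by
    rw [inner_smul_right, hg]
  have hC := C.2
  -- The Taylor remainder only needs C; the extra 1 keeps the opening positive.
  refine ⟨‖g‖⁻¹ • g, (C + 1) / ‖g‖, ρ, ?_, by positivity, hρ, fun w hw h => ?_, fun w hw h => ?_⟩
  · rw [norm_smul, norm_inv, norm_norm, inv_mul_cancel₀ hgn.ne']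
  · refine hneg _ (hball (by simpa using hw)) ?_
    rw [hval, div_mul_eq_mul_div, ← neg_div, inv_mul_eq_div, div_lt_div_iff_of_pos_right hgn] at h
    have := abs_le.1 (taylor w hw)
    nlinarith [sq_nonneg ‖w‖]
  · refine (hφ _ (hball (by simpa using hw))).2 ?_
    rw [hval, div_mul_eq_mul_div, inv_mul_eq_div, div_lt_div_iff_of_pos_right hgn] at h
    have := abs_le.1 (taylor w hw)
    nlinarith [sq_nonneg ‖w‖]

theorem norm_add_smul_sq (w e : Euc n) (he : ‖e‖ = 1) (d : ℝ) :
    ‖w + d • e‖ ^ 2 = ‖w‖ ^ 2 + 2 * d * inner ℝ w e + d ^ 2 := by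
  rw [norm_add_sq_real, inner_smul_right, norm_smul, he, mul_one, Real.norm_eq_abs, sq_abs]
  ring

/-- With w = y - x, membership in the ball says 2a⟨w, e⟩ ≤ -|w|², which is below -2ac|w|² because
2ac < 1. -/
theorem IsTrapped.closedBall_subset {F : Set (Euc n)} {x e : Euc n} {c ρ : ℝ}
    (h : IsTrapped F x e c ρ) {a : ℝ} (ha : 0 < a) (hac : 2 * a * c < 1) (haρ : 2 * a < ρ)
    {y : Euc n} (hy : y ∈ Metric.closedBall (x - a • e) a) (hyx : y ≠ x) : y ∈ interior F := by
  have h1 : y = x + (y - x) := by abel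
  have h2 : ‖(y - x) + a • e‖ ≤ a := by
    rw [Metric.mem_closedBall, dist_eq_norm] at hy
    rwa [show y - x + a • e = y - (x - a • e) by abel]
  have h3 : ‖y - x‖ ≤ 2 * a := by
    have h4 : y - x = ((y - x) + a • e) - a • e := by abel
    have h5 : ‖a • e‖ = a := by rw [norm_smul, h.norm_eq, mul_one, Real.norm_eq_abs, abs_of_pos ha]
    rw [h4]
    exact (norm_sub_le _ _).trans (by linarith)
  have h6 : 0 < ‖y - x‖ := norm_pos_iff.2 (sub_ne_zero.2 hyx)
  have h7 := pow_le_pow_left₀ (norm_nonneg _) h2 2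
  rw [norm_add_smul_sq _ _ h.norm_eq] at h7
  rw [h1]
  refine h.mem _ (h3.trans_lt haρ) ?_
  have h8 : 0 < ‖y - x‖ ^ 2 := by positivity
  have h9 : 2 * a * c * ‖y - x‖ ^ 2 < ‖y - x‖ ^ 2 := by nlinarith
  have h10 : 2 * a * inner ℝ (y - x) e < 2 * a * -(c * ‖y - x‖ ^ 2) := by nlinarith
  exact lt_of_mul_lt_mul_left h10 (by positivity)

/-- An inner tangent ball of radius R/2 occupies the fraction 2^{-n} of the ball of radius R about x
and misses the frontier. So no frontier point is a density point of the frontier. -/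
theorem HasCompactC11Boundary.volume_frontier {F : Set (Euc n)} (hF : HasCompactC11Boundary F) :
    volume (frontier F) = 0 := by
  have hm : MeasurableSet (frontier F) := isClosed_frontier.measurableSet
  have hfalse : ∀ᵐ x ∂(volume.restrict (frontier F)), False := by
    filter_upwards [Besicovitch.ae_tendsto_measure_inter_div volume (frontier F),
      ae_restrict_mem hm] with x hx hxF
    obtain ⟨e, c, ρ, h⟩ := hF.exists_isTrapped hxF
    set q : ℝ≥0∞ := ENNReal.ofReal ((1 / 2 : ℝ) ^ n)
    have hq : 1 - q < 1 := ENNReal.sub_lt_self ENNReal.one_ne_top one_ne_zero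
      (by simp only [q, ne_eq, ENNReal.ofReal_eq_zero, not_le]; positivity)
    have hev : ∀ᶠ R : ℝ in 𝓝[>] 0, volume (frontier F ∩ Metric.closedBall x R) /
        volume (Metric.closedBall x R) ≤ 1 - q := by
      have hc := h.pos_const
      have hb : 0 < min (1 / c) ρ := lt_min (by positivity) h.pos_radius
      filter_upwards [Ioo_mem_nhdsGT hb] with R hR
      have hR0 : 0 < R := hR.1
      have hRc : R < 1 / c := hR.2.trans_le (min_le_left _ _)
      have hRρ : R < ρ := hR.2.trans_le (min_le_right _ _)
      rw [lt_div_iff₀ hc] at hRc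
      set p := x - (R / 2) • e
      have hsub : Metric.ball p (R / 2) ⊆ Metric.closedBall x R := by
        refine Metric.ball_subset_closedBall.trans (Metric.closedBall_subset_closedBall' ?_)
        rw [dist_eq_norm, show p - x = -((R / 2) • e) by simp [p], norm_neg, norm_smul, h.norm_eq,
          Real.norm_eq_abs, abs_of_pos (half_pos hR0)]
        linarith
      have hdisj : Disjoint (frontier F ∩ Metric.closedBall x R) (Metric.ball p (R / 2)) := by
        rw [Set.disjoint_left]
        rintro y ⟨hy, -⟩ hyb
        have hyx : y ≠ x := by
          rintro rfl
          rw [Metric.mem_ball, dist_eq_norm, show y - p = (R / 2) • e by simp [p], norm_smul,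
            h.norm_eq, Real.norm_eq_abs, abs_of_pos (half_pos hR0)] at hyb
          linarith
        exact hy.2 (h.closedBall_subset (half_pos hR0) (by linarith) (by linarith)
          (Metric.ball_subset_closedBall hyb) hyx)
      have hV : volume (Metric.ball p (R / 2)) = q * volume (Metric.closedBall x R) := by
        rw [Measure.addHaar_closedBall _ _ hR0.le, Measure.addHaar_ball_of_pos _ _ (half_pos hR0),
          ← mul_assoc, ← ENNReal.ofReal_mul (by positivity), finrank_euclideanSpace_fin,
          ← mul_pow]
        congr 3
        ring
      have hV0 : volume (Metric.closedBall x R) ≠ 0 :=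
        (Metric.measure_closedBall_pos _ _ hR0).ne'
      have hVt : volume (Metric.closedBall x R) ≠ ∞ := measure_closedBall_lt_top.ne
      refine ENNReal.div_le_of_le_mul ?_
      rw [ENNReal.sub_mul (fun _ _ => hVt), one_mul, ← hV]
      refine ENNReal.le_sub_of_add_le_right ?_ ?_
      · exact measure_ball_lt_top.ne
      · rw [← measure_union hdisj measurableSet_ball]
        exact measure_mono (union_subset inter_subset_right hsub)
    exact absurd (le_of_tendsto hx hev) (not_le.2 hq)
  simpa using hfalse

theorem HasCompactC11Boundary.nullMeasurableSet {F : Set (Euc n)}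
    (hF : HasCompactC11Boundary F) : NullMeasurableSet F volume :=
  nullMeasurableSet_of_null_frontier hF.volume_frontier

end Geometry

/-! ### Potentials and truncated weights. -/

/-- The potential at `x` of a set for a weight with values in `[0, ∞]`. -/
noncomputable def pot {n : ℕ} (k : Euc n → ℝ≥0∞) (S : Set (Euc n)) (x : Euc n) : ℝ≥0∞ :=
  ∫⁻ y in S, k (x - y)

/-- The restriction of a weight to the complement of the ball of radius `ε`. -/
noncomputable def trunc {n : ℕ} (k : Euc n → ℝ≥0∞) (ε : ℝ) : Euc n → ℝ≥0∞ :=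
  {w | ε ≤ ‖w‖}.indicator k

section Potential

variable {n : ℕ} {k : Euc n → ℝ≥0∞}

theorem pot_mono {S T : Set (Euc n)} (h : S ⊆ T) (x : Euc n) : pot k S x ≤ pot k T x :=
  lintegral_mono_set h

theorem pot_mono_weight {k' : Euc n → ℝ≥0∞} (h : ∀ w, k w ≤ k' w) (S : Set (Euc n)) (x : Euc n) :
    pot k S x ≤ pot k' S x :=
  lintegral_mono fun _ => h _

theorem pot_union_le (S T : Set (Euc n)) (x : Euc n) :
    pot k (S ∪ T) x ≤ pot k S x + pot k T x :=
  lintegral_union_le _ _ _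

theorem pot_univ (x : Euc n) : pot k univ x = ∫⁻ z, k z := by
  rw [pot, setLIntegral_univ, lintegral_sub_left]

theorem pot_le (S : Set (Euc n)) (x : Euc n) : pot k S x ≤ ∫⁻ z, k z :=
  (pot_mono (subset_univ S) x).trans_eq (pot_univ x)

theorem pot_inter_add_sdiff (S : Set (Euc n)) {T : Set (Euc n)} (hT : NullMeasurableSet T volume)
    (x : Euc n) : pot k (S ∩ T) x + pot k (S \ T) x = pot k S x :=
  setLIntegral_inter_add_sdiff _ S hT

theorem pot_add_compl {T : Set (Euc n)} (hT : NullMeasurableSet T volume) (x : Euc n) :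
    pot k T x + pot k Tᶜ x = ∫⁻ z, k z := by
  rw [← pot_univ x, ← pot_inter_add_sdiff univ hT, univ_inter, compl_eq_univ_sdiff]

theorem pot_preimage_add (hk : IsWeight k) (S : Set (Euc n)) (x : Euc n) :
    pot k S x = ∫⁻ w in (fun w => x + w) ⁻¹' S, k w := by
  rw [pot, ← (measurePreserving_add_left volume x).setLIntegral_comp_preimage_emb
    (measurableEmbedding_addLeft x) (fun y => k (x - y))]
  simp_rw [sub_add_cancel_left, hk.even]

theorem pot_preimage_reflect (hk : IsWeight k) (S : Set (Euc n)) (x : Euc n) :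
    pot k ((fun y => x + x - y) ⁻¹' S) x = pot k S x := by
  rw [pot_preimage_add hk, pot_preimage_add hk S]
  have hmp : MeasurePreserving (fun w : Euc n => -w) volume volume :=
    Measure.measurePreserving_neg volume
  rw [← hmp.setLIntegral_comp_preimage_emb (MeasurableEquiv.neg (Euc n)).measurableEmbedding]
  simp_rw [hk.even]
  congr 2
  ext w
  simp only [mem_preimage]
  rw [show x + x - (x + -w) = x + w by abel]

/-- Evenness of k makes the potential at x invariant under point reflection in x; P absorbs the
points whose reflection is not controlled. -/
theorem pot_le_of_subset_reflect (hk : IsWeight k) {X Y P : Set (Euc n)} {x : Euc n}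
    (h : ∀ y ∈ X, y ∉ P → x + x - y ∈ Y) : pot k X x ≤ pot k Y x + pot k P x := by
  rw [← pot_preimage_reflect hk Y]
  refine (pot_mono (fun y hy => ?_) x).trans (pot_union_le _ _ x)
  by_cases hP : y ∈ P
  · exact Or.inr hP
  · exact Or.inl (h y hy hP)

theorem measurableSet_le_norm (ε : ℝ) : MeasurableSet {w : Euc n | ε ≤ ‖w‖} :=
  measurableSet_le measurable_const measurable_norm

theorem IsWeight.trunc (hk : IsWeight k) (ε : ℝ) : IsWeight (trunc k ε) := by
  refine ⟨hk.aemeasurable.indicator (measurableSet_le_norm ε), fun x => ?_⟩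
  simp only [KFlow.trunc, indicator, mem_ofPred_eq, norm_neg, hk.even]

theorem trunc_le (ε : ℝ) (w : Euc n) : trunc k ε w ≤ k w := indicator_le_self _ _ w

theorem pot_trunc (S : Set (Euc n)) (x : Euc n) (ε : ℝ) :
    pot (trunc k ε) S x = pot k (S \ Metric.ball x ε) x := by
  have h : ∀ y, trunc k ε (x - y) = (Metric.ball x ε)ᶜ.indicator (fun y => k (x - y)) y := by
    intro y
    simp only [trunc, indicator, mem_ofPred_eq, mem_compl_iff, Metric.mem_ball, not_lt,
      dist_comm y x, dist_eq_norm x y]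
  simp only [pot, h]
  rw [lintegral_indicator measurableSet_ball.compl, Measure.restrict_restrict
    measurableSet_ball.compl, inter_comm, sdiff_eq]

theorem lintegral_trunc_ne_top (hk1 : ∫⁻ z, ENNReal.ofReal (min 1 ‖z‖) * k z ≠ ∞) {ε : ℝ}
    (hε : 0 < ε) : ∫⁻ z, trunc k ε z ≠ ∞ := by
  have h : ∀ z, ENNReal.ofReal (min 1 ε) * trunc k ε z ≤ ENNReal.ofReal (min 1 ‖z‖) * k z := by
    intro z
    by_cases hz : ε ≤ ‖z‖
    · gcongr
      exact trunc_le _ _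
    · rw [trunc, indicator_of_notMem (by exact hz), mul_zero]
      exact zero_le
  have h1 := lintegral_mono (μ := volume) h
  rw [lintegral_const_mul' _ _ ENNReal.ofReal_ne_top] at h1
  intro htop
  rw [htop, ENNReal.mul_top (by simp [hε]), top_le_iff] at h1
  exact hk1 h1

theorem pot_trunc_ne_top (hk1 : ∫⁻ z, ENNReal.ofReal (min 1 ‖z‖) * k z ≠ ∞) {ε : ℝ}
    (hε : 0 < ε) (S : Set (Euc n)) (x : Euc n) : pot (trunc k ε) S x ≠ ∞ :=
  ne_top_of_le_ne_top (lintegral_trunc_ne_top hk1 hε) (pot_le S x)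

/-- Passing from a large to a small truncation radius adds the potential of a part of a ball. -/
theorem pot_trunc_eq_add (S : Set (Euc n)) (x : Euc n) {ε ε' : ℝ} (h : ε ≤ ε') :
    pot (trunc k ε) S x =
      pot (trunc k ε') S x + pot (trunc k ε) (S ∩ Metric.ball x ε') x := by
  rw [← pot_inter_add_sdiff S (T := Metric.ball x ε') measurableSet_ball.nullMeasurableSet,
    add_comm, pot_trunc (S \ _), pot_trunc S, sdiff_sdiff, union_eq_left.2 (Metric.ball_subset_ball h)]

end Potential

/-! ### Existence of the curvature of regular sets. -/

section Curvature

variable {n : ℕ} {K : Euc n → ℝ}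

theorem truncCurv_eq (hn : 1 ≤ n) (hK : IsKernel K) {F : Set (Euc n)}
    (hF : NullMeasurableSet F volume) (x : Euc n) {ε : ℝ} (hε : 0 < ε) :
    truncCurv K F x ε = (pot (trunc (wt K) ε) Fᶜ x).toReal - (pot (trunc (wt K) ε) F x).toReal := by
  have := nontrivial_euc hn
  have hk := hK.isWeight hn
  have hk1 := hK.lintegral_ne_top
  set μ := (volume : Measure (Euc n)).restrict (Metric.ball x ε)ᶜ
  have hKx : AEStronglyMeasurable (fun y => K (x - y)) volume := by
    have h1 : AEMeasurable K volume := by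
      refine (ENNReal.measurable_toReal.comp_aemeasurable hk.aemeasurable).congr ?_
      filter_upwards [ae_ne_zero hn] with w hw
      exact ENNReal.toReal_ofReal (hK.nonneg w hw)
    exact (h1.comp_quasiMeasurePreserving
      (Measure.measurePreserving_sub_left volume x).quasiMeasurePreserving).aestronglyMeasurable
  have hnn : ∀ᵐ y ∂μ, 0 ≤ K (x - y) := by
    filter_upwards [ae_restrict_mem measurableSet_ball.compl] with y hy
    refine hK.nonneg _ (sub_ne_zero.2 ?_)
    rintro rfl
    exact hy (Metric.mem_ball_self hε)
  have hpot : ∀ S, NullMeasurableSet S volume →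
      ∫⁻ y in S, ENNReal.ofReal (K (x - y)) ∂μ = pot (trunc (wt K) ε) S x := by
    intro S hS
    rw [pot_trunc, pot, Set.sdiff_eq, Measure.restrict_restrict₀
      (hS.mono_ac Measure.absolutelyContinuous_restrict)]
    rfl
  have hint : Integrable (fun y => K (x - y)) μ := by
    refine ⟨hKx.restrict, ?_⟩
    rw [hasFiniteIntegral_iff_ofReal hnn]
    have := hpot univ nullMeasurableSet_univ
    rw [setLIntegral_univ] at this
    rw [this]
    exact (pot_trunc_ne_top hk1 hε _ _).lt_top
  have hterm : ∀ S, NullMeasurableSet S volume →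
      Integrable (fun y => S.indicator (fun _ => (1 : ℝ)) y * K (x - y)) μ ∧
      ∫ y, S.indicator (fun _ => (1 : ℝ)) y * K (x - y) ∂μ =
        (pot (trunc (wt K) ε) S x).toReal := by
    intro S hS
    have e : (fun y => S.indicator (fun _ => (1 : ℝ)) y * K (x - y)) =
        S.indicator fun y => K (x - y) := by
      ext y
      by_cases hy : y ∈ S <;> simp [hy]
    have hS' : NullMeasurableSet S μ := hS.mono_ac Measure.absolutelyContinuous_restrict
    rw [e]
    refine ⟨hint.indicator₀ hS', ?_⟩
    rw [integral_indicator₀ hS', integral_eq_lintegral_of_nonneg_ae (ae_restrict_of_ae hnn)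
      hint.aestronglyMeasurable.restrict, hpot S hS]
  rw [truncCurv]
  simp_rw [sub_mul]
  rw [integral_sub (hterm _ hF.compl).1 (hterm _ hF).1, (hterm _ hF.compl).2, (hterm _ hF).2]

/-- The region between two tangent paraboloids at `x`. -/
def parabolic (x e : Euc n) (c ρ : ℝ) : Set (Euc n) :=
  {y | ‖y - x‖ < ρ ∧ |inner ℝ (y - x) e| ≤ c * ‖y - x‖ ^ 2}

theorem UniformlyParabolic.exists_pot_le (hK : UniformlyParabolic K) (hk : IsWeight (wt K)) {c : ℝ}
    (hc : 0 < c) {η : ℝ} (hη : 0 < η) :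
    ∃ ρ : ℝ, 0 < ρ ∧ ∀ x e : Euc n, ‖e‖ = 1 → ∀ c' ≤ c, ∀ ρ' ≤ ρ,
      pot (wt K) (parabolic x e c' ρ') x ≤ ENNReal.ofReal η := by
  obtain ⟨ρ, hρ, h⟩ := hK c hc η hη
  refine ⟨ρ, hρ, fun x e he c' hc' ρ' hρ' => le_trans ?_ (h e he)⟩
  rw [pot_preimage_add hk]
  refine lintegral_mono_set fun w hw => ?_
  simp only [parabolic, mem_preimage, mem_ofPred_eq, add_sub_cancel_left] at hw
  exact ⟨hw.1.trans_le hρ', hw.2.trans (by gcongr)⟩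

/-- Off the region between the paraboloids, reflection in x exchanges F and its complement inside
the ball. Their contributions to the annulus therefore cancel up to the mass of that region. -/
theorem IsTrapped.abs_truncCurv_sub_le (hn : 1 ≤ n) (hK : IsKernel K) {F : Set (Euc n)}
    (hF : NullMeasurableSet F volume) {x e : Euc n} {c ρ ρ' η : ℝ} (h : IsTrapped F x e c ρ)
    (hρ : ρ' ≤ ρ) (hη : 0 ≤ η) (hp : pot (wt K) (parabolic x e c ρ') x ≤ ENNReal.ofReal η)
    {ε ε' : ℝ} (hε : 0 < ε) (hεε : ε ≤ ε') (hε' : ε' < ρ') :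
    |truncCurv K F x ε - truncCurv K F x ε'| ≤ η := by
  have hk := hK.isWeight hn
  have hk1 := hK.lintegral_ne_top
  have h1 : pot (trunc (wt K) ε) (parabolic x e c ρ') x ≤ ENNReal.ofReal η :=
    (pot_mono_weight (trunc_le ε) _ _).trans hp
  have hfin := fun S => pot_trunc_ne_top hk1 hε S x
  have hfin' := fun S => pot_trunc_ne_top hk1 (hε.trans_le hεε) S x
  have hw : ∀ y ∈ Metric.ball x ε', ‖y - x‖ < ρ' := fun y hy => by
    rw [Metric.mem_ball, dist_eq_norm] at hy; linarith
  have e1 : ∀ y : Euc n, y = x + (y - x) := fun y => by abel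
  have e2 : ∀ y : Euc n, x + x - y = x + -(y - x) := fun y => by abel
  have hb : ∀ y ∈ Metric.ball x ε', x + x - y ∈ Metric.ball x ε' := fun y hy => by
    rw [Metric.mem_ball, dist_eq_norm] at hy ⊢
    rwa [e2, add_sub_cancel_left, norm_neg]
  have ha : pot (trunc (wt K) ε) (Fᶜ ∩ Metric.ball x ε') x ≤
      pot (trunc (wt K) ε) (F ∩ Metric.ball x ε') x + ENNReal.ofReal η := by
    refine (pot_le_of_subset_reflect (hk.trunc ε) (P := parabolic x e c ρ') ?_).trans
      (add_le_add_right h1 _)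
    rintro y ⟨hyF, hy⟩ hyP
    refine ⟨?_, hb y hy⟩
    have hy' := hw y hy
    have h2 : ¬ inner ℝ (y - x) e < -(c * ‖y - x‖ ^ 2) := fun h3 =>
      hyF (by rw [e1 y]; exact interior_subset (h.mem _ (hy'.trans_le hρ) h3))
    have h3 : ¬ |inner ℝ (y - x) e| ≤ c * ‖y - x‖ ^ 2 := fun h4 => hyP ⟨hy', h4⟩
    rw [e2]
    refine interior_subset (h.mem _ (by rw [norm_neg]; linarith) ?_)
    rw [inner_neg_left, norm_neg, neg_lt_neg_iff]
    rw [abs_le, not_and_or] at h3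
    rcases h3 with h3 | h3
    · exact absurd (not_le.1 h3) h2
    · exact not_le.1 h3
  have hb' : pot (trunc (wt K) ε) (F ∩ Metric.ball x ε') x ≤
      pot (trunc (wt K) ε) (Fᶜ ∩ Metric.ball x ε') x + ENNReal.ofReal η := by
    refine (pot_le_of_subset_reflect (hk.trunc ε) (P := parabolic x e c ρ') ?_).trans
      (add_le_add_right h1 _)
    rintro y ⟨hyF, hy⟩ hyP
    refine ⟨?_, hb y hy⟩
    have hy' := hw y hy
    have h2 : ¬ c * ‖y - x‖ ^ 2 < inner ℝ (y - x) e := fun h3 =>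
      h.notMem _ (hy'.trans_le hρ) h3 (by rwa [← e1 y])
    have h3 : ¬ |inner ℝ (y - x) e| ≤ c * ‖y - x‖ ^ 2 := fun h4 => hyP ⟨hy', h4⟩
    rw [e2]
    refine h.notMem _ (by rw [norm_neg]; linarith) ?_
    rw [inner_neg_left, norm_neg]
    rw [abs_le, not_and_or] at h3
    rcases h3 with h3 | h3
    · linarith
    · exact absurd (not_le.1 h3) h2
  have ha2 := ENNReal.toReal_mono (ENNReal.add_ne_top.2 ⟨hfin _, ENNReal.ofReal_ne_top⟩) ha
  have hb2 := ENNReal.toReal_mono (ENNReal.add_ne_top.2 ⟨hfin _, ENNReal.ofReal_ne_top⟩) hb'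
  rw [ENNReal.toReal_add (hfin _) ENNReal.ofReal_ne_top, ENNReal.toReal_ofReal hη] at ha2 hb2
  rw [truncCurv_eq hn hK hF x hε, truncCurv_eq hn hK hF x (hε.trans_le hεε),
    pot_trunc_eq_add Fᶜ x hεε, pot_trunc_eq_add F x hεε, ENNReal.toReal_add (hfin' _) (hfin _),
    ENNReal.toReal_add (hfin' _) (hfin _), abs_le]
  constructor <;> linarith

theorem IsTrapped.exists_tendsto_truncCurv (hn : 1 ≤ n) (hK : IsKernel K)
    (hKp : UniformlyParabolic K) {F : Set (Euc n)} (hF : NullMeasurableSet F volume) {x e : Euc n}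
    {c ρ : ℝ} (h : IsTrapped F x e c ρ) :
    ∃ L : ℝ, Tendsto (fun ε => truncCurv K F x ε) (𝓝[>] 0) (𝓝 L) := by
  refine cauchy_map_iff_exists_tendsto.1 (Metric.cauchy_iff.2 ⟨inferInstance, fun η hη => ?_⟩)
  obtain ⟨ρ', hρ', hp⟩ := hKp.exists_pot_le (hK.isWeight hn) h.pos_const (half_pos hη)
  have hm : 0 < min ρ' ρ := lt_min hρ' h.pos_radius
  refine ⟨(fun ε => truncCurv K F x ε) '' Ioo 0 (min ρ' ρ), image_mem_map (Ioo_mem_nhdsGT hm), ?_⟩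
  have key : ∀ ε ε' : ℝ, 0 < ε → ε ≤ ε' → ε' < min ρ' ρ →
      |truncCurv K F x ε - truncCurv K F x ε'| ≤ η / 2 := fun ε ε' h1 h2 h3 =>
    h.abs_truncCurv_sub_le hn hK hF (min_le_right _ _) (half_pos hη).le
      (hp x e h.norm_eq c le_rfl _ (min_le_left _ _)) h1 h2 h3
  rintro _ ⟨ε, hε, rfl⟩ _ ⟨ε', hε', rfl⟩
  rw [Real.dist_eq]
  rcases le_total ε ε' with hle | hle
  · linarith [key ε ε' hε.1 hle hε'.2]
  · rw [abs_sub_comm]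
    linarith [key ε' ε hε'.1 hle hε.2]

end Curvature

/-! ### Calibration by a foliation. -/

section Calibration

variable {n : ℕ} {k : Euc n → ℝ≥0∞}

/-- Inner regularity of the finite measure k dz: a compact part of S - x carrying almost all the
mass stays inside S - y for y near x. -/
theorem eventually_pot_le_pot_add (hk : IsWeight k) (hkf : ∫⁻ z, k z ≠ ∞) {S : Set (Euc n)}
    (hS : IsOpen S) (x : Euc n) {η : ℝ≥0∞} (hη : η ≠ 0) :
    ∀ᶠ y in 𝓝 x, pot k S x ≤ pot k S y + η := by
  set ν := (volume : Measure (Euc n)).withDensity k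
  have : IsFiniteMeasure ν := isFiniteMeasure_withDensity hkf
  have hpot : ∀ y, pot k S y = ν ((fun w => y + w) ⁻¹' S) := fun y => by
    rw [pot_preimage_add hk, withDensity_apply _ ((measurable_const_add y) hS.measurableSet)]
  rcases eq_or_ne (pot k S x) 0 with h0 | h0
  · exact Eventually.of_forall fun y => by rw [h0]; exact zero_le
  have hxt : pot k S x ≠ ∞ := ne_top_of_le_ne_top hkf (pot_le S x)
  have hlt : pot k S x - η < ν ((fun w => x + w) ⁻¹' S) := by
    rw [← hpot]; exact ENNReal.sub_lt_self hxt h0 hη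
  obtain ⟨κ, hκS, hκ, hκν⟩ :=
    (hS.preimage (continuous_const_add x)).exists_lt_isCompact hlt
  have hev : ∀ᶠ y in 𝓝 x, ∀ w ∈ κ, y + w ∈ S := by
    refine hκ.eventually_forall_of_forall_eventually fun w hw => ?_
    exact (continuous_fst.add continuous_snd).continuousAt.eventually_mem
      (hS.mem_nhds (hκS hw))
  filter_upwards [hev] with y hy
  rw [hpot y]
  exact tsub_le_iff_right.1 (hκν.le.trans (measure_mono hy))

/-- Interactions of a set with itself can be reordered along the level sets of a function. -/
theorem lintegral_pot_level_comm (hk : IsWeight k) {u : Euc n → ℝ} (hu : Measurable u)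
    (B : Set (Euc n)) :
    ∫⁻ y in B, pot k ({z | u y < u z} ∩ B) y = ∫⁻ y in B, pot k ({z | u z < u y} ∩ B) y := by
  have h1 : ∀ y, pot k ({z | u y < u z} ∩ B) y =
      ∫⁻ z in B, {p : Euc n × Euc n | u p.1 < u p.2}.indicator (fun p => k (p.1 - p.2)) (y, z) := by
    intro y
    have hm : MeasurableSet {z | u y < u z} := measurableSet_lt measurable_const hu
    rw [pot, ← Measure.restrict_restrict hm, ← lintegral_indicator hm]
    rfl
  have h2 : ∀ y, pot k ({z | u z < u y} ∩ B) y =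
      ∫⁻ z in B, {p : Euc n × Euc n | u p.1 < u p.2}.indicator (fun p => k (p.1 - p.2)) (z, y) := by
    intro y
    have hm : MeasurableSet {z | u z < u y} := measurableSet_lt hu measurable_const
    rw [pot, ← Measure.restrict_restrict hm, ← lintegral_indicator hm]
    refine lintegral_congr fun z => ?_
    simp only [indicator, mem_ofPred_eq, hk.sub_comm y z]
  simp_rw [h1, h2]
  exact lintegral_lintegral_swap (f := fun y z =>
    {p : Euc n × Euc n | u p.1 < u p.2}.indicator (fun p => k (p.1 - p.2)) (y, z))
    ((hk.aemeasurable_sub_restrict B B).indicator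
      (measurableSet_lt (hu.comp measurable_fst) (hu.comp measurable_snd)))

/-- If `B` is foliated by the boundaries of sets `{u < u y} ∪ C` along which the curvature is at most
`c`, then adding `B` to `A` changes the perimeter by at most `c |B|`. -/
theorem wint_le_of_foliation (hk : IsWeight k) (hkf : ∫⁻ z, k z ≠ ∞) {u : Euc n → ℝ}
    (hu : Measurable u) {A B C : Set (Euc n)} (hA : NullMeasurableSet A volume)
    (hB : NullMeasurableSet B volume) (hC : MeasurableSet C)
    (hBv : volume B ≠ ∞) (hCA : C ⊆ A) (hAB : Disjoint A B)
    (hlev : ∀ y ∈ B, {z | u z < u y} ⊆ A ∪ B) {c : ℝ≥0∞}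
    (hc : ∀ y ∈ B, pot k ({z | u z < u y} ∪ C)ᶜ y ≤ pot k ({z | u z < u y} ∪ C) y + c) :
    wint k B (A ∪ B)ᶜ ≤ c * volume B + wint k B A := by
  -- The curvature bound for the leaf through y, with the finite potential of the leaf cancelled.
  -- After integration over B the two terms internal to B agree by symmetry.
  have hpt : ∀ y ∈ B, pot k (A ∪ B)ᶜ y + pot k ({z | u y < u z} ∩ B) y ≤
      c + pot k A y + pot k ({z | u z < u y} ∩ B) y := by
    intro y hy
    set Fy := {z | u z < u y} ∪ C
    have hFm : NullMeasurableSet Fy volume :=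
      ((measurableSet_lt hu measurable_const).union hC).nullMeasurableSet
    have hfin : ∀ S, pot k S y ≠ ∞ := fun S => ne_top_of_le_ne_top hkf (pot_le S y)
    have h1 : pot k (A \ Fy) y + (pot k ({z | u y < u z} ∩ B) y + pot k (A ∪ B)ᶜ y) ≤
        pot k Fyᶜ y := by
      rw [← pot_inter_add_sdiff Fyᶜ hA, ← pot_inter_add_sdiff (Fyᶜ \ A) hB]
      refine add_le_add (pot_mono ?_ y) (add_le_add (pot_mono ?_ y) (pot_mono ?_ y))
      · rintro z ⟨h1, h2⟩
        exact ⟨h2, h1⟩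
      · rintro z ⟨h1, h2⟩
        rw [mem_ofPred_eq] at h1
        have hzA : z ∉ A := fun h => hAB.le_bot ⟨h, h2⟩
        refine ⟨⟨?_, hzA⟩, h2⟩
        rintro (h3 | h3)
        · rw [mem_ofPred_eq] at h3; linarith
        · exact hzA (hCA h3)
      · intro z hz
        rw [mem_compl_iff, mem_union, not_or] at hz
        refine ⟨⟨?_, hz.1⟩, hz.2⟩
        rintro (h3 | h3)
        · rcases hlev y hy h3 with h4 | h4
          · exact hz.1 h4
          · exact hz.2 h4
        · exact hz.1 (hCA h3)
    have h2 : pot k Fy y ≤ pot k (A ∩ Fy) y + pot k ({z | u z < u y} ∩ B) y := by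
      refine (pot_mono ?_ y).trans (pot_union_le _ _ y)
      intro z hz
      by_cases hzA : z ∈ A
      · exact Or.inl ⟨hzA, hz⟩
      · rcases hz with hz | hz
        · exact Or.inr ⟨hz, (hlev y hy hz).resolve_left hzA⟩
        · exact absurd (hCA hz) hzA
    refine (ENNReal.add_le_add_iff_left (hfin Fy)).1 ?_
    calc _ ≤ (pot k (A ∩ Fy) y + pot k ({z | u z < u y} ∩ B) y) +
          (pot k (A ∪ B)ᶜ y + pot k ({z | u y < u z} ∩ B) y) := by gcongr
      _ ≤ (pot k A y + pot k ({z | u z < u y} ∩ B) y) +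
          (pot k (A \ Fy) y + (pot k ({z | u y < u z} ∩ B) y + pot k (A ∪ B)ᶜ y)) := by
          refine add_le_add (add_le_add_left (pot_mono inter_subset_left y) _) ?_
          rw [add_comm (pot k (A ∪ B)ᶜ y)]
          exact le_add_self
      _ ≤ (pot k A y + pot k ({z | u z < u y} ∩ B) y) + (pot k Fy y + c) := by
          exact add_le_add le_rfl (h1.trans (hc y hy))
      _ = _ := by ring
  have hint : ∫⁻ y in B, (pot k (A ∪ B)ᶜ y + pot k ({z | u y < u z} ∩ B) y) ≤
      ∫⁻ y in B, (c + pot k A y + pot k ({z | u z < u y} ∩ B) y) := by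
    refine lintegral_mono_ae ?_
    filter_upwards [ae_restrict_mem₀ hB] with y hy using hpt y hy
  have hm : ∀ S, AEMeasurable (fun y => pot k S y) (volume.restrict B) := fun S =>
    hk.aemeasurable_inner B S
  have hm' : AEMeasurable (fun y => c + pot k A y) (volume.restrict B) :=
    aemeasurable_const.add (hm A)
  rw [lintegral_add_left' (hm _), lintegral_add_left' hm',
    lintegral_add_left' aemeasurable_const, setLIntegral_const, lintegral_pot_level_comm hk hu] at hint
  -- The internal term is finite only because k is integrable, which is why truncated kernels are
  -- used.
  have hJ : ∫⁻ y in B, pot k ({z | u z < u y} ∩ B) y ≠ ∞ := by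
    refine ne_top_of_le_ne_top (ENNReal.mul_ne_top hkf hBv) ?_
    rw [← setLIntegral_const]
    exact lintegral_mono fun y => pot_le _ y
  exact (ENNReal.add_le_add_iff_right hJ).1 hint

/-- Monotone convergence as ε decreases to 0. Disjointness keeps pairs off the diagonal, where the
truncated kernels vanish for every ε. -/
theorem wint_le_of_forall_trunc_le (hk : IsWeight k) {A B : Set (Euc n)}
    (hA : NullMeasurableSet A volume) (hB : NullMeasurableSet B volume) (hAB : Disjoint A B)
    {M : ℝ≥0∞} {ρ : ℝ} (hρ : 0 < ρ)
    (h : ∀ ε, 0 < ε → ε < ρ → wint (trunc k ε) A B ≤ M) : wint k A B ≤ M := by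
  obtain ⟨ε, hanti, hε, hlim⟩ := exists_seq_strictAnti_tendsto' hρ
  have hAB' : NullMeasurableSet (A ×ˢ B) ((volume : Measure (Euc n)).prod volume) := hA.prod hB
  have heq : wint k A B = ∫⁻ p in A ×ˢ B, ⨆ m, trunc k (ε m) (p.1 - p.2) ∂(volume.prod volume) := by
    rw [wint_eq_setLIntegral_prod hk]
    refine lintegral_congr_ae ?_
    filter_upwards [ae_restrict_mem₀ hAB'] with p hp
    have hne : p.1 - p.2 ≠ 0 := sub_ne_zero.2 fun he =>
      hAB.le_bot ⟨hp.1, by rw [he]; exact hp.2⟩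
    refine le_antisymm ?_ (iSup_le fun m => trunc_le _ _)
    obtain ⟨m, hm⟩ := (hlim.eventually_lt_const (norm_pos_iff.2 hne)).exists
    refine le_iSup_of_le m ?_
    rw [trunc, indicator_of_mem (by exact hm.le)]
  rw [heq, lintegral_iSup' (fun m => ((hk.trunc (ε m)).aemeasurable_sub).restrict)]
  · refine iSup_le fun m => ?_
    rw [← wint_eq_setLIntegral_prod (hk.trunc (ε m))]
    exact h _ (hε m).1 (hε m).2
  · refine ae_of_all _ fun p i j hij => ?_
    refine indicator_le_indicator_of_subset ?_ (fun _ => zero_le) _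
    exact fun w hw => le_trans (hanti.antitone hij) hw

end Calibration

/-! ### A foliation with curvature below δ near a touching point. -/

section Viscosity

variable {n : ℕ} {K : Euc n → ℝ}

/-- Inside a small ball the curvature of a sphere of radius `d` is at most the mass of the region
between two tangent paraboloids. -/
theorem pot_compl_le_of_ball {k : Euc n → ℝ≥0∞} (hk : IsWeight k) {F : Set (Euc n)} {p y : Euc n}
    {c ρ ρ' : ℝ} (hy : y ≠ p) (hc : 1 / (2 * dist y p) ≤ c) (hρ : ρ' ≤ ρ)
    (hF : {z | dist z p < dist y p} ⊆ F) :
    pot k (Fᶜ ∩ Metric.ball y ρ') y ≤ pot k (F ∩ Metric.ball y ρ') y +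
      pot k (parabolic y ((dist y p)⁻¹ • (y - p)) c ρ) y := by
  have hd : 0 < dist y p := dist_pos.2 hy
  set d := dist y p
  set e := d⁻¹ • (y - p)
  have he : ‖e‖ = 1 := by
    rw [norm_smul, norm_inv, Real.norm_eq_abs, abs_of_pos hd, ← dist_eq_norm,
      inv_mul_cancel₀ hd.ne']
  have hde : d • e = y - p := by rw [smul_smul, mul_inv_cancel₀ hd.ne', one_smul]
  have hsq : ∀ w : Euc n, dist (y + w) p ^ 2 = ‖w‖ ^ 2 + 2 * d * inner ℝ w e + d ^ 2 := by
    intro w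
    rw [← norm_add_smul_sq w e he d, hde, dist_eq_norm]
    congr 2
    abel
  refine pot_le_of_subset_reflect hk ?_
  rintro z ⟨hzF, hz⟩ hzP
  have hz' : ‖z - y‖ < ρ' := by rwa [Metric.mem_ball, dist_eq_norm] at hz
  have e2 : y + y - z = y + -(z - y) := by abel
  refine ⟨hF ?_, ?_⟩
  · have h1 : d ≤ dist z p := not_lt.1 fun h => hzF (hF h)
    have h2 : d ^ 2 ≤ dist z p ^ 2 := pow_le_pow_left₀ hd.le h1 2
    have h3 : dist z p ^ 2 = ‖z - y‖ ^ 2 + 2 * d * inner ℝ (z - y) e + d ^ 2 := by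
      rw [← hsq, add_sub_cancel]
    have h4 : ¬ |inner ℝ (z - y) e| ≤ c * ‖z - y‖ ^ 2 := fun h4 => hzP ⟨hz'.trans_le hρ, h4⟩
    have h5 : ‖z - y‖ ^ 2 ≤ 2 * d * (c * ‖z - y‖ ^ 2) := by
      rw [div_le_iff₀ (by positivity)] at hc
      nlinarith [sq_nonneg ‖z - y‖]
    have h6 : c * ‖z - y‖ ^ 2 < inner ℝ (z - y) e := by
      rw [abs_le, not_and_or] at h4
      rcases h4 with h4 | h4
      · exfalso
        have := not_le.1 h4
        nlinarith
      · exact not_le.1 h4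
    rw [mem_ofPred_eq, e2]
    refine lt_of_pow_lt_pow_left₀ 2 hd.le ?_
    rw [hsq, inner_neg_left, norm_neg]
    nlinarith
  · rw [e2, Metric.mem_ball, dist_eq_norm, add_sub_cancel_left, norm_neg]
    exact hz'

/-- A leaf is a ball concentric with the inner tangent ball, united with F away from x. Near y it is
a ball of radius at least a, whose curvature contribution is small by `UniformlyParabolic`. Away
from y the kernel is integrable, so the contribution is almost continuous in y and close to the
truncated curvature of F at x, which is below δ. -/
theorem IsTrapped.exists_foliation (hn : 1 ≤ n) (hK : IsKernel K) (hKp : UniformlyParabolic K)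
    {F : Set (Euc n)} (hF : NullMeasurableSet F volume) (hF0 : volume (frontier F) = 0)
    {x e : Euc n} {c ρ₀ : ℝ} (h : IsTrapped F x e c ρ₀) {a : ℝ} (ha : 0 < a) (hac : 2 * a * c < 1)
    (haρ : 2 * a < ρ₀) {L δ : ℝ} (hL : Tendsto (fun ε => truncCurv K F x ε) (𝓝[>] 0) (𝓝 L))
    (hLδ : L < δ) (hδ : 0 < δ) :
    ∃ C, MeasurableSet C ∧ C ⊆ F ∧ ∃ c₁ < ENNReal.ofReal δ, ∃ ρ > 0, ∃ r > 0,
      ∀ y ∈ Metric.ball x r, a ≤ dist y (x - a • e) → ∀ ε, 0 < ε → ε < ρ →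
        pot (trunc (wt K) ε) ({z | dist z (x - a • e) < dist y (x - a • e)} ∪ C)ᶜ y ≤
          pot (trunc (wt K) ε) ({z | dist z (x - a • e) < dist y (x - a • e)} ∪ C) y + c₁ := by
  have hk := hK.isWeight hn
  have hk1 := hK.lintegral_ne_top
  set p := x - a • e
  -- The maximum with 0 keeps the threshold nonnegative, as needed for `ENNReal.ofReal`.
  set c₀ := (max L 0 + δ) / 2
  have hm : max L 0 < δ := max_lt hLδ hδ
  have hm0 : 0 ≤ max L 0 := le_max_right _ _
  have hLc : L < c₀ := (le_max_left L 0).trans_lt (by simp only [c₀]; linarith)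
  have hc₀ : 0 ≤ c₀ := by simp only [c₀]; linarith
  have hc₀δ : c₀ < δ := by simp only [c₀]; linarith
  -- Five errors η will be spent: two for replacing F by F', two for moving from x to y, one for the
  -- ball near y.
  set η := (δ - c₀) / 8
  have hη : 0 < η := by simp only [η]; linarith
  have hxp : dist x p = a := by
    rw [dist_eq_norm, show x - p = a • e by simp [p], norm_smul, h.norm_eq, mul_one,
      Real.norm_eq_abs, abs_of_pos ha]
  set κ := max c (1 / (2 * a))
  obtain ⟨ρk, hρk, hpar⟩ := hKp.exists_pot_le hk (lt_max_of_lt_left h.pos_const : 0 < κ) hη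
  set ρ := min ρk ρ₀
  have hρ : 0 < ρ := lt_min hρk h.pos_radius
  obtain ⟨ρ₂, hcurv, hρ₂⟩ := ((hL.eventually_lt_const hLc).and
    (Ioo_mem_nhdsGT (show (0 : ℝ) < ρ / 4 by positivity))).exists
  have hρ₂0 : 0 < ρ₂ := hρ₂.1
  have hρ₂ρ : 4 * ρ₂ < ρ := by linarith [hρ₂.2]
  set C := interior F \ Metric.closedBall x (2 * ρ₂)
  have hC : IsOpen C := isOpen_interior.sdiff Metric.isClosed_closedBall
  have hCF : C ⊆ F := sdiff_subset.trans interior_subset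
  set F' := Metric.ball p a ∪ C
  have hF' : IsOpen F' := Metric.isOpen_ball.union hC
  have hF'F : F' ⊆ F := by
    refine union_subset (fun y hy => ?_) hCF
    refine interior_subset (h.closedBall_subset ha hac haρ (Metric.ball_subset_closedBall hy) ?_)
    rintro rfl
    exact absurd hxp (ne_of_lt hy)
  set k' := trunc (wt K) ρ₂
  have hfin := fun S y => pot_trunc_ne_top hk1 hρ₂0 S y
  -- What F' loses lies in the null frontier or close to x, between the tangent ball and the outer
  -- paraboloid.
  have h1 : pot k' (F \ F') x ≤ ENNReal.ofReal η := by
    have hsub : F \ F' ⊆ frontier F ∪ parabolic x e κ ρ := by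
      rintro y ⟨hyF, hyF'⟩
      by_cases hyi : y ∈ interior F
      · right
        have hy1 : y ∈ Metric.closedBall x (2 * ρ₂) := by
          by_contra hcon
          exact hyF' (Or.inr ⟨hyi, hcon⟩)
        rw [Metric.mem_closedBall, dist_eq_norm] at hy1
        have hy2 : a ≤ dist y p := not_lt.1 fun h => hyF' (Or.inl h)
        have hyρ : ‖y - x‖ < ρ := by linarith
        refine ⟨hyρ, abs_le.2 ⟨?_, ?_⟩⟩
        · have h2 : a ^ 2 ≤ dist y p ^ 2 := pow_le_pow_left₀ ha.le hy2 2
          rw [dist_eq_norm, show y - p = (y - x) + a • e by simp only [p]; abel,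
            norm_add_smul_sq _ _ h.norm_eq] at h2
          have h3 : 1 / (2 * a) ≤ κ := le_max_right _ _
          rw [div_le_iff₀ (by positivity)] at h3
          have h4 : ‖y - x‖ ^ 2 ≤ 2 * a * (κ * ‖y - x‖ ^ 2) := by
            nlinarith [sq_nonneg ‖y - x‖]
          have h5 : 2 * a * -(κ * ‖y - x‖ ^ 2) ≤ 2 * a * inner ℝ (y - x) e := by linarith
          exact le_of_mul_le_mul_left h5 (by positivity)
        · have h2 : inner ℝ (y - x) e ≤ c * ‖y - x‖ ^ 2 := not_lt.1 fun h3 =>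
            h.notMem (y - x) (hyρ.trans_le (min_le_right _ _)) h3 (by rwa [add_sub_cancel])
          exact h2.trans (mul_le_mul_of_nonneg_right (le_max_left _ _) (sq_nonneg _))
      · exact Or.inl ⟨subset_closure hyF, hyi⟩
    have h0 : pot k' (frontier F) x = 0 := setLIntegral_measure_zero _ _ hF0
    refine ((pot_mono hsub x).trans (pot_union_le _ _ x)).trans ?_
    rw [h0, zero_add]
    exact (pot_mono_weight (trunc_le _) _ _).trans
      (hpar x e h.norm_eq κ le_rfl ρ (min_le_left _ _))
  have h2 : pot k' Fᶜ x ≤ pot k' F x + ENNReal.ofReal c₀ := by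
    rw [truncCurv_eq hn hK hF x hρ₂0] at hcurv
    rw [← ENNReal.ofReal_toReal (hfin Fᶜ x), ← ENNReal.ofReal_toReal (hfin F x),
      ← ENNReal.ofReal_add ENNReal.toReal_nonneg hc₀]
    exact ENNReal.ofReal_le_ofReal (by linarith)
  have h3 : pot k' F'ᶜ x ≤ pot k' F' x + (ENNReal.ofReal c₀ + 2 * ENNReal.ofReal η) := by
    have e1 : F'ᶜ ⊆ Fᶜ ∪ (F \ F') := fun y hy => by
      by_cases hyF : y ∈ F
      · exact Or.inr ⟨hyF, hy⟩
      · exact Or.inl hyF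
    have e2 : F ⊆ F' ∪ (F \ F') := fun y hy => by
      by_cases hyF : y ∈ F'
      · exact Or.inl hyF
      · exact Or.inr ⟨hy, hyF⟩
    calc pot k' F'ᶜ x ≤ pot k' Fᶜ x + pot k' (F \ F') x :=
          (pot_mono e1 x).trans (pot_union_le _ _ x)
      _ ≤ (pot k' F x + ENNReal.ofReal c₀) + ENNReal.ofReal η := add_le_add h2 h1
      _ ≤ ((pot k' F' x + ENNReal.ofReal η) + ENNReal.ofReal c₀) + ENNReal.ofReal η := by
          gcongr
          exact ((pot_mono e2 x).trans (pot_union_le _ _ x)).trans (add_le_add le_rfl h1)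
      _ = _ := by ring
  have hη' : ENNReal.ofReal η ≠ 0 := by simpa using hη
  obtain ⟨r, hr, hnear⟩ := Metric.eventually_nhds_iff.1 (eventually_pot_le_pot_add
    (hk.trunc ρ₂) (lintegral_trunc_ne_top hk1 hρ₂0) hF' x hη')
  refine ⟨C, hC.measurableSet, hCF, ENNReal.ofReal (c₀ + 5 * η), ?_, ρ₂, hρ₂0, min r ρ₂,
    lt_min hr hρ₂0, ?_⟩
  · rw [ENNReal.ofReal_lt_ofReal_iff hδ]
    simp only [η]
    linarith
  intro y hy hay ε hε hερ
  have hyr : dist y x < r := (Metric.mem_ball.1 hy).trans_le (min_le_left _ _)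
  have hyρ : dist y x < ρ₂ := (Metric.mem_ball.1 hy).trans_le (min_le_right _ _)
  -- Lower semicontinuity for the open set F' suffices: its potential and that of its complement add
  -- up to a constant.
  have h4 : pot k' F'ᶜ y ≤ pot k' F' y + (ENNReal.ofReal c₀ + 4 * ENNReal.ofReal η) := by
    have h5 := hnear hyr
    refine (ENNReal.add_le_add_iff_left (hfin F' y)).1 ?_
    have hFm := hF'.measurableSet.nullMeasurableSet (μ := volume)
    rw [pot_add_compl hFm, ← pot_add_compl hFm x]
    calc _ ≤ pot k' F' x + (pot k' F' x + (ENNReal.ofReal c₀ + 2 * ENNReal.ofReal η)) := by gcongr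
      _ ≤ (pot k' F' y + ENNReal.ofReal η) + ((pot k' F' y + ENNReal.ofReal η) +
          (ENNReal.ofReal c₀ + 2 * ENNReal.ofReal η)) := by gcongr
      _ = _ := by ring
  set Fy := {z | dist z p < dist y p} ∪ C
  have hF'y : F' ⊆ Fy :=
    union_subset_union_left _ fun z hz => (Metric.mem_ball.1 hz).trans_le hay
  have hyp : y ≠ p := by
    rintro rfl
    rw [dist_self] at hay
    linarith
  have hd : 0 < dist y p := dist_pos.2 hyp
  have h5 : pot (trunc (wt K) ε) (Fyᶜ ∩ Metric.ball y ρ₂) y ≤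
      pot (trunc (wt K) ε) (Fy ∩ Metric.ball y ρ₂) y + ENNReal.ofReal η := by
    have h6 : 1 / (2 * dist y p) ≤ κ :=
      le_trans (by gcongr) (le_max_right c (1 / (2 * a)))
    refine (pot_compl_le_of_ball (hk.trunc ε) hyp h6 (by linarith : ρ₂ ≤ ρ)
      subset_union_left).trans (add_le_add le_rfl ?_)
    refine (pot_mono_weight (trunc_le _) _ _).trans (hpar y _ ?_ κ le_rfl ρ (min_le_left _ _))
    rw [norm_smul, norm_inv, Real.norm_eq_abs, abs_of_pos hd, ← dist_eq_norm,
      inv_mul_cancel₀ hd.ne']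
  rw [pot_trunc_eq_add Fyᶜ y hερ.le, pot_trunc_eq_add Fy y hερ.le]
  have h7 : ENNReal.ofReal (c₀ + 5 * η) = ENNReal.ofReal c₀ + 5 * ENNReal.ofReal η := by
    rw [ENNReal.ofReal_add hc₀ (by positivity), ENNReal.ofReal_mul (by norm_num)]
    norm_num
  calc _ ≤ (pot k' F' y + (ENNReal.ofReal c₀ + 4 * ENNReal.ofReal η)) +
        (pot (trunc (wt K) ε) (Fy ∩ Metric.ball y ρ₂) y + ENNReal.ofReal η) :=
        add_le_add ((pot_mono (compl_subset_compl.2 hF'y) y).trans h4) h5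
    _ ≤ (pot k' Fy y + (ENNReal.ofReal c₀ + 4 * ENNReal.ofReal η)) +
        (pot (trunc (wt K) ε) (Fy ∩ Metric.ball y ρ₂) y + ENNReal.ofReal η) := by
        gcongr
        exact pot_mono hF'y y
    _ = _ := by rw [h7]; ring

end Viscosity

/-! ### The viscosity inequality and the choice of the time step. -/

section Main

variable {n : ℕ} {K : Euc n → ℝ}

theorem wint_mono_weight {k k' : Euc n → ℝ≥0∞} (h : ∀ w, k w ≤ k' w) (A B : Set (Euc n)) :
    wint k A B ≤ wint k' A B :=
  lintegral_mono fun _ => lintegral_mono fun _ => h _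

/-- Adding a set of finite positive measure to an outward minimizing set costs perimeter. -/
theorem Admissible.lt_wint (hk : IsWeight (wt K))
    (hk1 : ∫⁻ z, ENNReal.ofReal (min 1 ‖z‖) * wt K z ≠ ∞) {Ω A B : Set (Euc n)} {δ c : ℝ≥0∞}
    {R : ℝ} (hR : 0 < R) (hA : Admissible (wt K) Ω δ R A) (hB : NullMeasurableSet B volume)
    (hBΩ : CompactlyIn B Ω) (hAB : Disjoint A B) (hB0 : volume B ≠ 0) (hc : c < δ) :
    c * volume B + wint (wt K) B A < wint (wt K) B (A ∪ B)ᶜ := by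
  have hper := hA.wper_ne_top hk hk1 hR
  have hmin := hA.outMin (A ∪ B) (hA.nullMeasurable.union hB) subset_union_left
    (hA.compactlyIn.union hBΩ)
  have e1 : Aᶜ = B ∪ (A ∪ B)ᶜ := by
    ext z
    have : z ∈ B → z ∉ A := fun h1 h2 => hAB.le_bot ⟨h2, h1⟩
    simp only [mem_compl_iff, mem_union]; tauto
  have e2 : Disjoint B (A ∪ B)ᶜ := by
    rw [Set.disjoint_left]; exact fun z h1 h2 => h2 (Or.inr h1)
  have hperA : wper (wt K) A = wint (wt K) A B + wint (wt K) A (A ∪ B)ᶜ := by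
    rw [wper, ← wint_union_right hk _ _ (hA.nullMeasurable.union hB).compl e2, ← e1]
  rw [union_sdiff_left, hAB.symm.sdiff_eq_left, hperA, wper, wint_union_left _ _ hB hAB,
    add_right_comm, add_comm (wint (wt K) A (A ∪ B)ᶜ)] at hmin
  rw [hperA, ENNReal.add_ne_top] at hper
  rw [ENNReal.add_le_add_iff_right hper.2, wint_comm hk A B] at hmin
  refine lt_of_lt_of_le ?_ hmin
  rw [add_comm, wint_comm hk B A]
  refine ENNReal.add_lt_add_left hper.1 ?_
  exact (ENNReal.mul_lt_mul_iff_left hB0 (volume_ne_top_of_compactlyIn hBΩ)).2 hc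

/-- If the curvature at x were below δ, the part B outside A of a slightly enlarged inner tangent
ball would be foliated by leaves of curvature at most c₁ < δ. Adding B to A would then be too cheap
for an outward minimizing set. -/
theorem Admissible.viscCurvGE (hn : 1 ≤ n) (hK : IsKernel K) (hKp : UniformlyParabolic K)
    {Ω A : Set (Euc n)} {δ R : ℝ} (hΩ : IsOpen Ω) (hδ : 0 < δ) (hR : 0 < R)
    (hA : Admissible (wt K) Ω (ENNReal.ofReal δ) R A) (hAo : ContainsFullOpens A) {x : Euc n}
    (hx : x ∈ frontier A) : ViscCurvGE K A x δ := by
  intro F hF hFA hxF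
  have hk := hK.isWeight hn
  have hk1 := hK.lintegral_ne_top
  have hFm := hF.nullMeasurableSet
  obtain ⟨e, c, ρ₀, h⟩ := hF.exists_isTrapped hxF
  obtain ⟨L, hL⟩ := h.exists_tendsto_truncCurv hn hK hKp hFm
  refine ⟨L, (continuous_coe_real_ereal.tendsto L).comp hL, ?_⟩
  rw [EReal.coe_le_coe_iff]
  by_contra! hLδ
  have hc := h.pos_const
  obtain ⟨a, ha, hac, haρ⟩ : ∃ a : ℝ, 0 < a ∧ 2 * a * c < 1 ∧ 2 * a < ρ₀ := by
    have hm : 0 < min (1 / c) ρ₀ := lt_min (by positivity) h.pos_radius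
    refine ⟨min (1 / c) ρ₀ / 4, by positivity, ?_, ?_⟩
    · have : min (1 / c) ρ₀ * c ≤ 1 := by
        rw [← le_div_iff₀ hc]; exact min_le_left _ _
      linarith
    · linarith [min_le_right (1 / c) ρ₀]
  obtain ⟨C, hC, hCF, c₁, hc₁, ρ, hρ, r, hr, hfol⟩ :=
    h.exists_foliation hn hK hKp hFm hF.volume_frontier ha hac haρ hL hLδ hδ
  set p := x - a • e
  have hxp : dist x p = a := by
    rw [dist_eq_norm, show x - p = a • e by simp [p], norm_smul, h.norm_eq, mul_one,
      Real.norm_eq_abs, abs_of_pos ha]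
  obtain ⟨s, hs, hsΩ⟩ := Metric.isOpen_iff.1 hΩ x (hA.compactlyIn.2 hx.1)
  have hV : IsOpen (interior F ∪ Metric.ball x (min r (s / 2))) :=
    isOpen_interior.union Metric.isOpen_ball
  -- The closed tangent ball meets the complement of the interior of F only at x, so a slightly
  -- larger ball leaves F only close to x.
  obtain ⟨t, ht, htV⟩ := (isCompact_closedBall p a).exists_thickening_subset_open hV (by
    intro y hy
    by_cases hyx : y = x
    · subst hyx
      exact Or.inr (Metric.mem_ball_self (lt_min hr (half_pos hs)))
    · exact Or.inl (h.closedBall_subset ha hac haρ hy hyx))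
  rw [thickening_closedBall ht ha.le] at htV
  set B := Metric.ball p (t + a) \ A
  have hB : NullMeasurableSet B volume :=
    measurableSet_ball.nullMeasurableSet.diff hA.nullMeasurable
  have hBx : B ⊆ Metric.ball x (min r (s / 2)) := by
    rintro y ⟨hy, hyA⟩
    exact (htV hy).resolve_left fun h1 => hyA (hFA (interior_subset h1))
  have hBΩ : CompactlyIn B Ω := by
    have hsub : closure B ⊆ Metric.closedBall x (s / 2) := closure_minimal
      (hBx.trans (Metric.ball_subset_closedBall.trans
        (Metric.closedBall_subset_closedBall (min_le_right _ _)))) Metric.isClosed_closedBall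
    exact ⟨(isCompact_closedBall x (s / 2)).of_isClosed_subset isClosed_closure hsub,
      hsub.trans ((Metric.closedBall_subset_ball (half_lt_self hs)).trans hsΩ)⟩
  have hAB : Disjoint A B := disjoint_sdiff_right
  have hB0 : volume B ≠ 0 := by
    intro h0
    -- Were B null, A would contain the enlarged ball and x would be an interior point.
    have hsub := hAo _ Metric.isOpen_ball h0
    refine hx.2 (interior_maximal hsub Metric.isOpen_ball ?_)
    rw [Metric.mem_ball, hxp]
    linarith
  refine absurd ?_ (not_le.2 (hA.lt_wint hk hk1 hR hB hBΩ hAB hB0 hc₁))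
  refine wint_le_of_forall_trunc_le hk hB (hA.nullMeasurable.union hB).compl ?_ hρ ?_
  · rw [Set.disjoint_left]; exact fun z h1 h2 => h2 (Or.inr h1)
  intro ε hε hερ
  refine (wint_le_of_foliation (hk.trunc ε) (lintegral_trunc_ne_top hk1 hε)
    (u := fun z => dist z p) (by fun_prop) hA.nullMeasurable hB hC
    (volume_ne_top_of_compactlyIn hBΩ) (hCF.trans hFA) hAB ?_ ?_).trans
    (add_le_add le_rfl (wint_mono_weight (trunc_le ε) _ _))
  · intro y hy z hz
    by_cases hzA : z ∈ A
    · exact Or.inl hzA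
    · exact Or.inr ⟨lt_trans hz (Metric.mem_ball.1 hy.1), hzA⟩
  · intro y hy
    refine hfol y (Metric.ball_subset_ball (min_le_left _ _) (hBx hy)) ?_ ε hε hερ
    by_contra! hlt
    refine hy.2 (hFA (interior_subset (h.closedBall_subset ha hac haρ hlt.le ?_)))
    rintro rfl
    exact hlt.ne hxp

/-- The cutting cost q per unit volume is finite and depends only on r, n and K, so h₀ = (r/2)/(q +
1) makes the penalty r/(2h) exceed it. -/
theorem exists_time_step (hK : IsKernel K) {r : ℝ} (hr : 0 < r) :
    ∃ h₀ : ℝ, 0 < h₀ ∧ ∀ h, 0 < h → h ≤ h₀ →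
      (∫⁻ z, ENNReal.ofReal (min (r - r / 2) ‖z‖) * wt K z) / ENNReal.ofReal (r - r / 2) <
        ENNReal.ofReal (1 / h) * ENNReal.ofReal (r / 2) := by
  set q := (∫⁻ z, ENNReal.ofReal (min (r - r / 2) ‖z‖) * wt K z) / ENNReal.ofReal (r - r / 2)
  have hq : q ≠ ∞ := ENNReal.div_ne_top (lintegral_min_mul_ne_top hK.lintegral_ne_top _)
    (by simpa using hr)
  have hq0 : 0 ≤ q.toReal := ENNReal.toReal_nonneg
  refine ⟨r / 2 / (q.toReal + 1), by positivity, fun h hh hle => ?_⟩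
  rw [← ENNReal.ofReal_mul (by positivity), ← ENNReal.ofReal_toReal hq,
    ENNReal.ofReal_lt_ofReal_iff (by positivity), one_div_mul_eq_div, lt_div_iff₀ hh]
  rw [le_div_iff₀ (by positivity)] at hle
  linarith

theorem admissible_of_stronglyOutwardMinimizing (hk : IsWeight (wt K)) {Ω E : Set (Euc n)}
    (hΩ : IsOpen Ω) (hE : NullMeasurableSet E volume) (hEΩ : CompactlyIn E Ω) {r δ h : ℝ}
    (hr : ENNReal.ofReal r ≤ bdryDist E Ω) (hδ : 0 < δ) (hmin : StronglyOutwardMinimizing K Ω E δ)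
    (hh : ENNReal.ofReal h ≤ bdryDist E Ω / ENNReal.ofReal δ) :
    Admissible (wt K) Ω (ENNReal.ofReal δ) (max r (δ * h)) E := by
  have h1 : ENNReal.ofReal (δ * h) ≤ bdryDist E Ω := by
    rw [ENNReal.le_div_iff_mul_le (Or.inl (by simpa using hδ)) (Or.inl ENNReal.ofReal_ne_top)] at hh
    rwa [mul_comm δ, ENNReal.ofReal_mul' hδ.le]
  refine ⟨hE, hEΩ, fun y hy x hx => max_le ?_ ?_, hmin.outMin hk hΩ hEΩ.subset⟩
  · exact farFromCompl_of_le_bdryDist hΩ hEΩ hr y hy x hx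
  · exact farFromCompl_of_le_bdryDist hΩ hEΩ h1 y hy x hx

end Main

end KFlow

theorem mainTheorem7 (n : ℕ) (hn : 1 ≤ n) (K : KFlow.Euc n → ℝ) (hK : KFlow.IsKernel K)
    (r : ℝ) (hr : 0 < r) :
    ∃ h₀ : ℝ, 0 < h₀ ∧
      ∀ Ω E : Set (KFlow.Euc n), IsOpen Ω → NullMeasurableSet E volume → E.Nonempty →
        KFlow.CompactlyIn E Ω → ENNReal.ofReal r ≤ KFlow.bdryDist E Ω →
      ∀ δ : ℝ, 0 < δ → KFlow.StronglyOutwardMinimizing K Ω E δ →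
      ∀ h : ℝ, 0 < h → h ≤ h₀ →
        ENNReal.ofReal h ≤ KFlow.bdryDist E Ω / ENNReal.ofReal δ →
        (interior E = ∅ → ∀ B : Set (KFlow.Euc n), KFlow.IsStep K h E B ↔ B = ∅) ∧
        ((interior E).Nonempty → KFlow.ContainsFullOpens E →
          ∀ Eh : ℝ → Set (KFlow.Euc n), KFlow.IsDiscreteFlow K h E Eh →
          ∀ t : ℝ, 0 ≤ t →
            ENNReal.ofReal (δ * h) ≤ KFlow.bdryDist (Eh t) (Eh (t + h)) ∧
            (KFlow.UniformlyParabolic K →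
              ∀ x ∈ frontier (Eh t), KFlow.ViscCurvGE K (Eh t) x δ)) := by
  have hk := hK.isWeight hn
  have hk1 := hK.lintegral_ne_top
  obtain ⟨h₀, hh₀, hstep⟩ := KFlow.exists_time_step hK hr
  refine ⟨h₀, hh₀, fun Ω E hΩ hE hne hEΩ hrE δ hδ hmin h hh hhh₀ hhδ => ?_⟩
  have hrh := hstep h hh hhh₀
  have hadm := KFlow.admissible_of_stronglyOutwardMinimizing hk hΩ hE hEΩ hrE hδ hmin hhδ
  refine ⟨fun hEi B => KFlow.isStep_iff_of_interior_eq_empty hn hk hk1 hδ hr (le_max_left _ _) hrh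
    hadm hne hEi, ?_⟩
  rintro - hEo Eh ⟨A, hA0, hA, hEh⟩ t ht
  have hinv : ∀ m, KFlow.Admissible (KFlow.wt K) Ω (ENNReal.ofReal δ) (max r (δ * h)) (A m) ∧
      KFlow.ContainsFullOpens (A m) := by
    intro m
    induction m with
    | zero => rw [hA0]; exact ⟨hadm, hEo⟩
    | succ m ih =>
      obtain ⟨h1, h2, -⟩ := ih.1.step hn hk hk1 hδ hh (le_max_right _ _) hr (le_max_left _ _) hrh
        ih.2 (hA m)
      exact ⟨h1, h2⟩
  set m := ⌊t / h⌋₊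
  have hm1 : m * h ≤ t := by
    rw [← le_div_iff₀ hh]; exact Nat.floor_le (by positivity)
  have hm2 : t < (m + 1) * h := by
    rw [← div_lt_iff₀ hh]; exact Nat.lt_floor_add_one _
  have e1 : Eh t = A m := hEh m t ⟨hm1, hm2⟩
  have e2 : Eh (t + h) = A (m + 1) := by
    refine hEh (m + 1) _ ⟨?_, ?_⟩ <;> push_cast <;> linarith
  rw [e1, e2]
  obtain ⟨-, -, hball⟩ := (hinv m).1.step hn hk hk1 hδ hh (le_max_right _ _) hr (le_max_left _ _)
    hrh (hinv m).2 (hA m)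
  exact ⟨KFlow.le_bdryDist_of_ball_subset hball, fun hKp x hx =>
    (hinv m).1.viscCurvGE hn hK hKp hΩ hδ (hr.trans_le (le_max_left _ _)) (hinv m).2 hx⟩
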